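/- Let $\Omega\subset\mathbb{R}^d$ be compact and convex with non-empty interior $\Omega^\circ$, and let $p_0,p_1$ be probability densities on $\Omega$ that are continuous and satisfy $\underline{p}\le p_j\le\overline{p}$ on $\Omega$ for some constants $0<\underline p\le\overline p<\infty$. For positive functions $q_0,q_1$ on $\Omega$, for $z\in\Omega^\circ$ and $t\in[0,1]$ put $S_t(z)=\{\delta\in\mathbb{R}^d: z-t\delta\in\Omega,\ z+(1-t)\delta\in\Omega\}$, $$v_{q_0,q_1}(t,z)=\frac{\int_{S_t(z)}\delta\,q_0(z-t\delta)\,q_1(z+(1-t)\delta)\,d\delta}{\int_{S_t(z)}q_0(z-t\delta)\,q_1(z+(1-t)\delta)\,d\delta},\qquad \omega_{q_0,q_1}(\eta)=\sup_{z,z'\in\Omega,\ \|z-z'\|\le\eta}\ \max_{j=0,1}\Bigl|\frac{q_j(z)}{q_j(z')}-1\Bigr| .$$ Let $v=v_{p_0,p_1}$ (that is, $v(t,z)=\mathbb{E}[X_1-X_0\mid (1-t)X_0+tX_1=z]$ for independent $X_0\sim p_0$, $X_1\sim p_1$) and $\omega=\omega_{p_0,p_1}$. For estimators $\widehat p_0,\widehat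 p_1>0$ on $\Omega$ let $\widehat v=v_{\widehat p_0,\widehat p_1}$, $\widehat\omega=\omega_{\widehat p_0,\widehat p_1}$, and suppose that $$r_n=\sup_{x\in\Omega}\max_{j=0,1}\bigl|\ln(\widehat p_j(x)/p_j(x))\bigr|<\infty .$$ Suppose that both $\omega$ and $\widehat\omega$ satisfy the Osgood condition: $\int_1^{u}\frac{ds}{s+\omega(s)}\to-\infty$ as $u\downarrow0$, and likewise for $\widehat\omega$. Let $\Psi(u)=\int_1^u\frac{ds}{s+\omega(s)}$ for $u>0$, with the conventions $\Psi(0)=-\infty$ and $\Psi^{-1}(-\infty)=0$. Then for every $x\in\Omega^\circ$ the integral equations $$\mathfrak{R}(t,x)=x+\int_0^t v(s,\mathfrak{R}(s,x))\,ds,\qquad \widehat{\mathfrak{R}}(t,x)=x+\int_0^t\widehat v(s,\widehat{\mathfrak{R}}(s,x))\,ds,\qquad t\in[0,1],$$ each have a unique solution on $[0,1]$ with values in $\Omega^\circ$ for $t<1$, and every solution on a shorter interval $[0,T]$ with values in $\Omega^\circ$ for $t<T$ is a restriction of it. Moreover, there is a constant $C>0$, depending only on $d$, $\mathrm{diam}(\Omega)$,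 $\underline p$ and $\overline p$, such that for all $\varepsilon,\gamma>0$ and all $x$ whose closed $\varepsilon$-ball is contained in $\Omega$ and for which $\mathrm{dist}(\mathfrak{R}(1,x),\partial\Omega)\ge2\gamma$, $$\|\widehat{\mathfrak{R}}(1,x)-\mathfrak{R}(1,x)\|\le\Psi^{-1}\Bigl(\Psi\bigl(2\,\mathrm{diam}(\Omega)(e^{4r_n}-1)\bigr)+\frac{C}{\min\{\varepsilon,\gamma\}}\ln\Bigl(\frac{\mathrm{diam}(\Omega)}{\varepsilon}\Bigr)+\frac{C}{\varepsilon\gamma}\Bigr).$$ If, in addition, $\omega(u)\le Lu$ for all $u\ge0$, then $$\|\widehat{\mathfrak{R}}(1,x)-\mathfrak{R}(1,x)\|\le2\,\mathrm{diam}(\Omega)(e^{4r_n}-1)\exp\Bigl(\frac{C(L+1)}{\min\{\varepsilon,\gamma\}}\ln\Bigl(\frac{\mathrm{diam}(\Omega)}{\varepsilon}\Bigr)+\frac{C(L+1)}{\varepsilon\gamma}\Bigr).$$ -/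

import Mathlib

open MeasureTheory Set Filter Topology

noncomputable section

namespace RectifiedFlow

/-- Points of `ℝ^d`, with the Euclidean norm and Lebesgue measure. -/
abbrev Pt (d : ℕ) : Type := EuclideanSpace ℝ (Fin d)

variable {d : ℕ}

/-- `Ω^{-ε}`: the points whose closed `ε`-ball lies in `Ω`. -/
def erosion (Ω : Set (Pt d)) (ε : ℝ) : Set (Pt d) :=
  {x | Metric.closedBall x ε ⊆ Ω}

/-- `p` is a Lebesgue probability density on `Ω`, continuous there, with values in `[lo, hi]`.
Values of `p` outside `Ω` are never used. -/
structure IsDensityOn (Ω : Set (Pt d)) (lo hi : ℝ) (p : Pt d → ℝ) : Prop where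
  continuousOn : ContinuousOn p Ω
  lower : ∀ x ∈ Ω, lo ≤ p x
  upper : ∀ x ∈ Ω, p x ≤ hi
  integral_eq_one : ∫ x in Ω, p x = 1

/-- The set `S_t(z) = (z - Ω)/t ∩ (Ω - z)/(1 - t)` of admissible displacements, written so that it
also makes sense at `t = 0` and `t = 1`. -/
def admissible (Ω : Set (Pt d)) (t : ℝ) (z : Pt d) : Set (Pt d) :=
  {δ | z - t • δ ∈ Ω ∧ z + (1 - t) • δ ∈ Ω}

/-- The velocity field of the pair `(p₀, p₁)`, both regarded as supported on `Ω`: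
`v(t,z) = ∫_{S_t(z)} δ p₀(z-tδ) p₁(z+(1-t)δ) dδ / ∫_{S_t(z)} p₀(z-tδ) p₁(z+(1-t)δ) dδ`.
For densities it is the conditional expectation `E[X₁ - X₀ | (1-t)X₀ + tX₁ = z]` for independent
`X₀ ∼ p₀`, `X₁ ∼ p₁`; see `condExp_ae_eq_velocity` below. -/
def velocity (Ω : Set (Pt d)) (p₀ p₁ : Pt d → ℝ) (t : ℝ) (z : Pt d) : Pt d :=
  (∫ δ in admissible Ω t z, p₀ (z - t • δ) * p₁ (z + (1 - t) • δ))⁻¹ •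
    ∫ δ in admissible Ω t z, (p₀ (z - t • δ) * p₁ (z + (1 - t) • δ)) • δ

/-- `velocity` is the regular version of the conditional expectation: if `X₀` and `X₁` are
independent with densities `p₀` and `p₁` on `Ω`, then `E[X₁ - X₀ | X_t] = v(t, X_t)` almost surely,
where `X_t = (1 - t) X₀ + t X₁`. -/
theorem condExp_ae_eq_velocity {S : Type*} [mS : MeasurableSpace S] (P : Measure S)
    [IsProbabilityMeasure P] (X₀ X₁ : S → Pt d) (hX₀ : Measurable X₀) (hX₁ : Measurable X₁)
    (hind : ProbabilityTheory.IndepFun X₀ X₁ P) (Ω : Set (Pt d)) (hΩ : IsCompact Ω)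
    (p₀ p₁ : Pt d → ℝ) (hc₀ : ContinuousOn p₀ Ω) (hc₁ : ContinuousOn p₁ Ω)
    (hp₀ : ∀ x ∈ Ω, 0 ≤ p₀ x) (hp₁ : ∀ x ∈ Ω, 0 ≤ p₁ x)
    (hl₀ : P.map X₀ = (volume.restrict Ω).withDensity fun x => ENNReal.ofReal (p₀ x))
    (hl₁ : P.map X₁ = (volume.restrict Ω).withDensity fun x => ENNReal.ofReal (p₁ x)) (t : ℝ) :
    P[fun a => X₁ a - X₀ a |
        MeasurableSpace.comap (fun a => (1 - t) • X₀ a + t • X₁ a) inferInstance]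
      =ᵐ[P] fun a => velocity Ω p₀ p₁ t ((1 - t) • X₀ a + t • X₁ a) := by
  classical
  have hmΩ := hΩ.measurableSet
  -- extend the densities by zero
  set g₀ : Pt d → ℝ := Ω.indicator p₀ with hg₀
  set g₁ : Pt d → ℝ := Ω.indicator p₁ with hg₁
  have mg₀ : Measurable g₀ := by
    have := hc₀.measurable_piecewise (g := fun _ => (0 : ℝ)) continuousOn_const hmΩ
    rw [hg₀, ← Set.piecewise_eq_indicator]
    exact this
  have mg₁ : Measurable g₁ := by
    have := hc₁.measurable_piecewise (g := fun _ => (0 : ℝ)) continuousOn_const hmΩ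
    rw [hg₁, ← Set.piecewise_eq_indicator]
    exact this
  have g₀0 : ∀ x, 0 ≤ g₀ x := fun x => Set.indicator_nonneg hp₀ x
  have g₁0 : ∀ x, 0 ≤ g₁ x := fun x => Set.indicator_nonneg hp₁ x
  have ext : ∀ p : Pt d → ℝ, ((volume.restrict Ω).withDensity fun x => ENNReal.ofReal (p x))
      = volume.withDensity fun x => ENNReal.ofReal (Ω.indicator p x) := by
    intro p
    rw [← withDensity_indicator hmΩ]
    congr 1
    ext x
    by_cases hx : x ∈ Ω <;> simp [hx]
  rw [ext p₀, ← hg₀] at hl₀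
  rw [ext p₁, ← hg₁] at hl₁
  -- the joint density of displacement and position
  set h : Pt d → Pt d → ℝ := fun z δ => g₀ (z - t • δ) * g₁ (z + (1 - t) • δ) with hh
  have h0 : ∀ z δ, 0 ≤ h z δ := fun z δ => mul_nonneg (g₀0 _) (g₁0 _)
  have mh : Measurable (fun q : Pt d × Pt d => h q.1 q.2) := by
    simp only [hh]; fun_prop
  have madm : ∀ z, MeasurableSet (admissible Ω t z) := fun z => by
    have m1 : Measurable fun δ : Pt d => z - t • δ := by fun_prop
    have m2 : Measurable fun δ : Pt d => z + (1 - t) • δ := by fun_prop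
    exact (m1 hmΩ).inter (m2 hmΩ)
  have hind_eq : ∀ z δ, h z δ = (admissible Ω t z).indicator
      (fun δ => p₀ (z - t • δ) * p₁ (z + (1 - t) • δ)) δ := by
    intro z δ
    simp only [hh, hg₀, hg₁, admissible, Set.indicator, Set.mem_ofPred_eq]
    split_ifs <;> simp_all
  have vel : ∀ z, velocity Ω p₀ p₁ t z = (∫ δ, h z δ)⁻¹ • ∫ δ, h z δ • δ := by
    intro z
    unfold velocity
    rw [← integral_indicator (madm z), ← integral_indicator (madm z)]
    congr 2
    · simp only [hind_eq]
    · ext1 δ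
      rw [hind_eq]
      by_cases hδ : δ ∈ admissible Ω t z <;> simp [hδ]
  have mden : StronglyMeasurable fun z => ∫ δ, h z δ :=
    mh.stronglyMeasurable.integral_prod_right
  have mnum : StronglyMeasurable fun z => ∫ δ, h z δ • δ :=
    StronglyMeasurable.integral_prod_right (f := fun z δ : Pt d => h z δ • δ)
      (mh.smul measurable_snd).stronglyMeasurable
  have mvel : StronglyMeasurable (velocity Ω p₀ p₁ t) := by
    have : velocity Ω p₀ p₁ t = fun z => (∫ δ, h z δ)⁻¹ • ∫ δ, h z δ • δ := funext vel
    rw [this]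
    exact (mden.measurable.inv.smul mnum.measurable).stronglyMeasurable
  -- the law of (X_t, X₁ - X₀)
  set Z : S → Pt d := fun a => (1 - t) • X₀ a + t • X₁ a with hZ
  have mZ : Measurable Z := by fun_prop
  set W : S → Pt d × Pt d := fun a => (Z a, X₁ a - X₀ a) with hW
  have mW : Measurable W := by fun_prop
  have joint : P.map (fun a => (X₀ a, X₁ a)) =
      ((volume : Measure (Pt d)).prod volume).withDensity
        fun q => ENNReal.ofReal (g₀ q.1 * g₁ q.2) := by
    rw [(ProbabilityTheory.indepFun_iff_map_prod_eq_prod_map_map hX₀.aemeasurable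
      hX₁.aemeasurable).1 hind, hl₀, hl₁, prod_withDensity (by fun_prop) (by fun_prop)]
    congr 1
    ext q
    rw [ENNReal.ofReal_mul (g₀0 _)]
  set T : Pt d × Pt d → Pt d × Pt d := fun q => (q.1 - t • q.2, q.1 + (1 - t) • q.2) with hT
  set U : Pt d × Pt d → Pt d × Pt d := fun q => ((1 - t) • q.1 + t • q.2, q.2 - q.1) with hU
  have mT : Measurable T := by fun_prop
  have mU : Measurable U := by fun_prop
  have UT : ∀ q, U (T q) = q := by
    intro q
    ext1
    · simp only [hU, hT]; module
    · simp only [hU, hT]; module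
  have presT : MeasurePreserving T ((volume : Measure (Pt d)).prod volume)
      ((volume : Measure (Pt d)).prod volume) := by
    have s1 : MeasurePreserving (fun q : Pt d × Pt d => (q.1, q.2 - t • q.1))
        ((volume : Measure (Pt d)).prod volume) ((volume : Measure (Pt d)).prod volume) := by
      refine (MeasurePreserving.id (volume : Measure (Pt d))).skew_product
        (g := fun a b => b - t • a) (by fun_prop) (Filter.Eventually.of_forall fun a => ?_)
      exact map_sub_right_eq_self volume (t • a)
    have s2 := measurePreserving_prod_add (volume : Measure (Pt d)) (volume : Measure (Pt d))
    have sw := Measure.measurePreserving_swap (μ := (volume : Measure (Pt d)))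
      (ν := (volume : Measure (Pt d)))
    have s := s2.comp (sw.comp (s1.comp sw))
    convert s using 1
    ext1 q
    simp only [hT, Function.comp, Prod.swap]
    ext1
    · rfl
    · simp only; module
  have law : P.map W = ((volume : Measure (Pt d)).prod volume).withDensity
      fun q => ENNReal.ofReal (h q.1 q.2) := by
    have hWU : W = U ∘ fun a => (X₀ a, X₁ a) := rfl
    rw [hWU, ← Measure.map_map mU (by fun_prop), joint]
    ext B hB
    rw [Measure.map_apply mU hB, withDensity_apply _ (mU hB), withDensity_apply _ hB,
      ← presT.setLIntegral_comp_preimage (mU hB) (by fun_prop)]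
    have : T ⁻¹' (U ⁻¹' B) = B := by ext q; simp [UT]
    rw [this]
  have transfer : ∀ F : Pt d × Pt d → Pt d, Measurable F → ∀ B : Set (Pt d), MeasurableSet B →
      ∫ a in Z ⁻¹' B, F (W a) ∂P = ∫ q in B ×ˢ univ, h q.1 q.2 • F q
        ∂((volume : Measure (Pt d)).prod volume) := by
    intro F hF B hB
    have e1 : Z ⁻¹' B = W ⁻¹' (B ×ˢ univ) := by ext a; simp [hW]
    rw [e1, ← setIntegral_map (hB.prod MeasurableSet.univ) hF.aestronglyMeasurable mW.aemeasurable,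
      law, setIntegral_withDensity_eq_setIntegral_toReal_smul (by fun_prop)
        (Filter.Eventually.of_forall fun _ => by simp) _ (hB.prod MeasurableSet.univ)]
    congr 1
    ext1 q
    rw [ENNReal.toReal_ofReal (h0 _ _)]
  -- integrability
  obtain ⟨K, hK⟩ := hΩ.isBounded.exists_norm_le
  have bd : ∀ z δ, h z δ ≠ 0 → ‖δ‖ ≤ 2 * K := by
    intro z δ hne
    have hδ : δ ∈ admissible Ω t z := by
      by_contra hcon
      exact hne (by rw [hind_eq]; simp [hcon])
    have e : δ = (z + (1 - t) • δ) - (z - t • δ) := by module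
    rw [e]
    refine (norm_sub_le _ _).trans ?_
    linarith [hK _ hδ.1, hK _ hδ.2]
  have hint : Integrable (fun q : Pt d × Pt d => h q.1 q.2)
      ((volume : Measure (Pt d)).prod volume) := by
    refine ⟨mh.aestronglyMeasurable, ?_⟩
    rw [hasFiniteIntegral_iff_ofReal (Filter.Eventually.of_forall fun q => h0 _ _)]
    have : (P.map W) univ = 1 := by
      rw [Measure.map_apply mW MeasurableSet.univ]; simp
    rw [law, withDensity_apply _ MeasurableSet.univ, Measure.restrict_univ] at this
    rw [this]; exact ENNReal.one_lt_top
  have smul_le : ∀ z δ, ‖h z δ • δ‖ ≤ h z δ * (2 * K) := by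
    intro z δ
    rw [norm_smul, Real.norm_of_nonneg (h0 _ _)]
    by_cases hne : h z δ = 0
    · simp [hne]
    · exact mul_le_mul_of_nonneg_left (bd z δ hne) (h0 _ _)
  have hint2 : Integrable (fun q : Pt d × Pt d => h q.1 q.2 • q.2)
      ((volume : Measure (Pt d)).prod volume) :=
    (hint.mul_const (2 * K)).mono' (mh.smul measurable_snd).aestronglyMeasurable
      (Filter.Eventually.of_forall fun q => smul_le _ _)
  have slice : ∀ᵐ z : Pt d, Integrable (fun δ => h z δ) := hint.prod_right_ae
  have velbd : ∀ z, ‖velocity Ω p₀ p₁ t z‖ ≤ 2 * |K| := by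
    intro z
    rw [vel, norm_smul, norm_inv]
    by_cases hz : Integrable (fun δ => h z δ)
    · have hd0 : 0 ≤ ∫ δ, h z δ := integral_nonneg (h0 z)
      have : ‖∫ δ, h z δ • δ‖ ≤ (∫ δ, h z δ) * (2 * |K|) := by
        rw [← integral_mul_const]
        refine norm_integral_le_of_norm_le (hz.mul_const _)
          (Filter.Eventually.of_forall fun δ => (smul_le z δ).trans ?_)
        exact mul_le_mul_of_nonneg_left (by linarith [le_abs_self K]) (h0 _ _)
      rw [Real.norm_of_nonneg hd0]
      rcases hd0.eq_or_lt with h1 | h1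
      · rw [← h1]; simp
      · rw [inv_mul_le_iff₀ h1]; linarith
    · rw [integral_undef hz]; simp
  have hdX : Integrable (fun a => X₁ a - X₀ a) P := by
    have hae : ∀ X : S → Pt d, Measurable X → ∀ g : Pt d → ℝ,
        P.map X = volume.withDensity (fun x => ENNReal.ofReal (Ω.indicator g x)) →
        Measurable (Ω.indicator g) → Integrable X P := by
      intro X hX g hlaw hmg
      refine Integrable.of_bound hX.aestronglyMeasurable K ?_
      have hmem : ∀ᵐ a ∂P, X a ∈ Ω := by
        refine ae_of_ae_map (p := fun x => x ∈ Ω) hX.aemeasurable ?_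
        rw [hlaw, ae_withDensity_iff (by fun_prop)]
        refine Filter.Eventually.of_forall fun x hx => ?_
        by_contra hcon
        exact hx (by simp [hcon])
      filter_upwards [hmem] with a ha using hK _ ha
    exact (hae X₁ hX₁ p₁ hl₁ mg₁).sub (hae X₀ hX₀ p₀ hl₀ mg₀)
  have hvX : Integrable (fun a => velocity Ω p₀ p₁ t (Z a)) P :=
    Integrable.of_bound (mvel.measurable.comp mZ).aestronglyMeasurable (2 * |K|)
      (Filter.Eventually.of_forall fun a => velbd _)
  refine (ae_eq_condExp_of_forall_setIntegral_eq mZ.comap_le hdX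
    (fun s _ _ => hvX.integrableOn) ?_ ?_).symm
  · rintro s ⟨B, hB, rfl⟩ -
    have l := transfer (fun q => velocity Ω p₀ p₁ t q.1) (mvel.measurable.comp measurable_fst) B hB
    have r := transfer (fun q => q.2) measurable_snd B hB
    simp only [hW] at l r
    rw [l, r]
    have hvq : Integrable (fun q : Pt d × Pt d => h q.1 q.2 • velocity Ω p₀ p₁ t q.1)
        ((volume : Measure (Pt d)).prod volume) := by
      refine (hint.mul_const (2 * |K|)).mono'
        (mh.smul (mvel.measurable.comp measurable_fst)).aestronglyMeasurable
        (Filter.Eventually.of_forall fun q => ?_)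
      rw [norm_smul, Real.norm_of_nonneg (h0 _ _)]
      exact mul_le_mul_of_nonneg_left (velbd _) (h0 _ _)
    rw [setIntegral_prod _ hvq.integrableOn, setIntegral_prod _ hint2.integrableOn]
    simp only [Measure.restrict_univ]
    refine integral_congr_ae (ae_restrict_of_ae ?_)
    filter_upwards [slice] with z hz
    rw [integral_smul_const, vel, smul_smul]
    by_cases h1 : ∫ δ, h z δ = 0
    · have h2 : (fun δ => h z δ) =ᵐ[volume] 0 := (integral_eq_zero_iff_of_nonneg (h0 z) hz).1 h1
      have h3 : ∫ δ, h z δ • δ = 0 := by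
        rw [← integral_zero (Pt d) (Pt d) (μ := volume)]
        refine integral_congr_ae ?_
        filter_upwards [h2] with δ hδ
        simp [hδ]
      rw [h3, smul_zero]
    · rw [mul_inv_cancel₀ h1, one_smul]
  · exact (mvel.comp_measurable (comap_measurable Z)).aestronglyMeasurable

/-- The modulus of continuity of the ratios
`ω(η) = sup_{z, z' ∈ Ω, ‖z - z'‖ ≤ η} max_j |p_j(z) / p_j(z') - 1|`. -/
def ratioModulus (Ω : Set (Pt d)) (p₀ p₁ : Pt d → ℝ) (η : ℝ) : ℝ :=
  sSup {r | ∃ z ∈ Ω, ∃ z' ∈ Ω, ‖z - z'‖ ≤ η ∧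
    r = max |p₀ z / p₀ z' - 1| |p₁ z / p₁ z' - 1|}

/-- A primitive `u ↦ ∫ du / (u + ω(u))` on `(0, ∞)`, based at `1`. The choice of the base point
changes neither `IsOsgood` nor the value of `Ψ⁻¹(Ψ(a) + b)`. -/
def psiReal (ω : ℝ → ℝ) (u : ℝ) : ℝ :=
  ∫ s in (1 : ℝ)..u, 1 / (s + ω s)

/-- The Osgood condition on `u + ω(u)`: `Ψ(ε) → -∞` as `ε ↓ 0`. -/
def IsOsgood (ω : ℝ → ℝ) : Prop :=
  Tendsto (psiReal ω) (𝓝[>] 0) atBot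

open Classical in
/-- `Ψ` on `[0, ∞)`, with `Ψ(0) = -∞`. -/
def psi (ω : ℝ → ℝ) (u : ℝ) : EReal :=
  if 0 < u then (psiReal ω u : EReal) else ⊥

/-- The inverse of `Ψ : [0, ∞) → [-∞, ∞)`; in particular `Ψ⁻¹(-∞) = 0`. -/
def psiInv (ω : ℝ → ℝ) (y : EReal) : ℝ :=
  sSup {u | 0 ≤ u ∧ psi ω u ≤ y}

/-- `max_j |ln (q_j(x) / p_j(x))|`. -/
def logRatio (p₀ p₁ q₀ q₁ : Pt d → ℝ) (x : Pt d) : ℝ :=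
  max |Real.log (q₀ x / p₀ x)| |Real.log (q₁ x / p₁ x)|

/-- The estimation error `sup_{x ∈ Ω} max_j |ln (q_j(x) / p_j(x))|`. -/
def logRatioError (Ω : Set (Pt d)) (p₀ p₁ q₀ q₁ : Pt d → ℝ) : ℝ :=
  sSup (logRatio p₀ p₁ q₀ q₁ '' Ω)

/-- `y` is a Carathéodory solution on `[0, T]` of `y(t) = x + ∫₀ᵗ v(s, y(s)) ds`. A velocity field
is only meaningful in the interior of `Ω`, so the path has to stay there before time `T`. -/
structure IsSolution (Ω : Set (Pt d)) (v : ℝ → Pt d → Pt d) (x : Pt d) (T : ℝ)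
    (y : ℝ → Pt d) : Prop where
  mem_interior : ∀ t ∈ Ico 0 T, y t ∈ interior Ω
  integrable : IntervalIntegrable (fun s => v s (y s)) volume 0 T
  eq_integral : ∀ t ∈ Icc 0 T, y t = x + ∫ s in (0 : ℝ)..t, v s (y s)

/-- The flow of `v` from `x` is uniquely defined: there is a solution on `[0, 1]`, and every
solution, on `[0, 1]` or on a shorter interval, is a restriction of it. -/
def HasUniqueFlow (Ω : Set (Pt d)) (v : ℝ → Pt d → Pt d) (x : Pt d) : Prop :=
  ∃ y, IsSolution Ω v x 1 y ∧
    ∀ T ∈ Ioc (0 : ℝ) 1, ∀ y', IsSolution Ω v x T y' → EqOn y' y (Icc 0 T)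

end RectifiedFlow

end

/-! The velocity v(t,z) is the barycentre of the weight p₀(z-tδ)p₁(z+(1-t)δ) on the convex set
S_t(z), so v(t,z) lies in S_t(z): from z, following v for the remaining time 1-t leads to a point of
Ω, and following it backwards for time t does too. Hence a solution from x has the form R(t) =
(1-t)x + tw with w ∈ Ω, and by time reversal also R(t) = tR(1) + (1-t)w' with w' ∈ Ω. By convexity
the ball of radius (1-t)ε about R(t) stays in Ω, and so does the ball of radius tγ if the path ends
that deep inside; together they give depth min{ε,γ}/2 at all times.

Two barycentres differ by at most 2 diam(Ω) times the L¹ distance of the weights divided by the mass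
of one of them. If the densities change, the weights change by a relative error of at most e^{2r}-1.
If z moves to z', the weights on the common part of S_t(z) and S_t(z') have ratios controlled by
ω(‖z-z'‖), and the symmetric difference has relative volume O(‖z-z'‖/ρ) at depth ρ, because
(1-l)S_t(z) ⊆ S_t(z') with l proportional to ‖z-z'‖/ρ. So at depth ρ the velocity oscillates by at
most K(u+ω(u)), where u = ‖z-z'‖ and K is a constant times 1+1/ρ.

The distance u(t) of the two flows therefore satisfies u ≤ a + ∫K(u+ω(u)), and Osgood's argument
yields Ψ(u(1)) ≤ Ψ(a)+K; for a = 0 it yields u = 0, which also proves uniqueness. The same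
inequality makes Euler paths a Cauchy family on [0,T] for T < 1, since they too keep a positive
depth, and their limit is the flow. Because 2ε ≤ diam(Ω), the logarithm ln(diam(Ω)/ε) is at least ln
2, so K is dominated by the first term of the claimed exponent.

Depth is needed only along R, and only the oscillation of v enters K, so the constant does not see
the estimators. These need not be normalised, as factors cancel in v, and their continuity follows
from the Osgood condition. -/

namespace RectifiedFlow

variable {d : ℕ}

/-- `p` is continuous on `Ω` with values in `[lo, hi]`. -/
structure IsWeightOn (Ω : Set (Pt d)) (lo hi : ℝ) (p : Pt d → ℝ) : Prop where
  continuousOn : ContinuousOn p Ω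
  lower : ∀ x ∈ Ω, lo ≤ p x
  upper : ∀ x ∈ Ω, p x ≤ hi

theorem IsDensityOn.isWeightOn {Ω : Set (Pt d)} {lo hi : ℝ} {p : Pt d → ℝ}
    (h : IsDensityOn Ω lo hi p) : IsWeightOn Ω lo hi p :=
  ⟨h.continuousOn, h.lower, h.upper⟩

/-! ### Barycentres of mass distributions -/

theorem norm_integral_smul_le {F : Pt d → ℝ} {D : ℝ} (hF : Integrable F)
    (hF0 : ∀ δ, 0 ≤ F δ) (hFD : ∀ δ, F δ ≠ 0 → ‖δ‖ ≤ D) :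
    ‖∫ δ, F δ • δ‖ ≤ D * ∫ δ, F δ := by
  rw [← integral_const_mul]
  refine norm_integral_le_of_norm_le (hF.const_mul D) (Eventually.of_forall fun δ => ?_)
  rw [norm_smul, Real.norm_of_nonneg (hF0 δ), mul_comm]
  by_cases h : F δ = 0
  · simp [h]
  · exact mul_le_mul_of_nonneg_right (hFD δ h) (hF0 δ)

theorem integrable_smul_self {F : Pt d → ℝ} {D : ℝ} (hF : Integrable F)
    (hFD : ∀ δ, F δ ≠ 0 → ‖δ‖ ≤ D) : Integrable fun δ => F δ • δ := by
  refine (hF.norm.const_mul D).mono' (hF.aestronglyMeasurable.smul aestronglyMeasurable_id)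
    (Eventually.of_forall fun δ => ?_)
  rw [norm_smul, mul_comm]
  by_cases h : F δ = 0
  · simp [h]
  · exact mul_le_mul_of_nonneg_right (hFD δ h) (norm_nonneg _)

theorem norm_mean_le {F : Pt d → ℝ} {D : ℝ} (hD : 0 ≤ D) (hF0 : ∀ δ, 0 ≤ F δ)
    (hFD : ∀ δ, F δ ≠ 0 → ‖δ‖ ≤ D) :
    ‖(∫ δ, F δ)⁻¹ • ∫ δ, F δ • δ‖ ≤ D := by
  by_cases hF : Integrable F
  · have h := norm_integral_smul_le hF hF0 hFD
    have h0 : 0 ≤ ∫ δ, F δ := integral_nonneg hF0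
    rw [norm_smul, norm_inv, Real.norm_of_nonneg h0]
    rcases h0.eq_or_lt with h1 | h1
    · rw [← h1]; simpa using hD
    · rw [inv_mul_le_iff₀ h1, mul_comm]; exact h
  · rw [integral_undef hF]; simpa using hD

/-- Comparison of the barycentres of two finite mass distributions on a ball. -/
theorem norm_mean_sub_mean_le {F G : Pt d → ℝ} {D : ℝ} (hD : 0 ≤ D)
    (hF : Integrable F) (hG : Integrable G) (hF0 : ∀ δ, 0 ≤ F δ)
    (hFD : ∀ δ, F δ ≠ 0 → ‖δ‖ ≤ D) (hGD : ∀ δ, G δ ≠ 0 → ‖δ‖ ≤ D)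
    (hFpos : 0 < ∫ δ, F δ) (hGpos : 0 < ∫ δ, G δ) :
    ‖(∫ δ, G δ)⁻¹ • (∫ δ, G δ • δ) - (∫ δ, F δ)⁻¹ • ∫ δ, F δ • δ‖ ≤
      2 * D * (∫ δ, |G δ - F δ|) / ∫ δ, G δ := by
  set m := (∫ δ, F δ)⁻¹ • ∫ δ, F δ • δ with hm
  have hmD : ‖m‖ ≤ D := norm_mean_le hD hF0 hFD
  have iF := integrable_smul_self hF hFD
  have iG := integrable_smul_self hG hGD
  have e1 : ∫ δ, F δ • δ = (∫ δ, F δ) • m := by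
    rw [hm, smul_smul, mul_inv_cancel₀ hFpos.ne', one_smul]
  -- Centring at the mean m of F kills the contribution of F, so the difference of the means is an
  -- integral against G - F, divided by the mass of G alone.
  have e2 : ∫ δ, (G δ - F δ) • (δ - m) = (∫ δ, G δ • δ) - (∫ δ, G δ) • m := by
    have : ∀ δ, (G δ - F δ) • (δ - m) = (G δ • δ - F δ • δ) - (G δ • m - F δ • m) := by
      intro δ; module
    simp_rw [this]
    have i1 : Integrable fun δ => G δ • δ - F δ • δ := iG.sub iF
    have i2 : Integrable fun δ => G δ • m - F δ • m := (hG.smul_const m).sub (hF.smul_const m)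
    rw [integral_sub i1 i2, integral_sub iG iF, integral_sub (hG.smul_const m) (hF.smul_const m),
      integral_smul_const, integral_smul_const, e1]
    abel
  have e3 : (∫ δ, G δ)⁻¹ • (∫ δ, G δ • δ) - m
      = (∫ δ, G δ)⁻¹ • ∫ δ, (G δ - F δ) • (δ - m) := by
    rw [e2, smul_sub, smul_smul, inv_mul_cancel₀ hGpos.ne', one_smul]
  rw [e3, norm_smul, norm_inv, Real.norm_of_nonneg hGpos.le, div_eq_inv_mul]
  refine mul_le_mul_of_nonneg_left ?_ (inv_nonneg.2 hGpos.le)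
  rw [← integral_const_mul]
  refine norm_integral_le_of_norm_le ((hG.sub hF).abs.const_mul _)
    (Eventually.of_forall fun δ => ?_)
  rw [norm_smul, Real.norm_eq_abs, mul_comm]
  by_cases h : G δ = 0 ∧ F δ = 0
  · simp [h.1, h.2]
  · have hδ : ‖δ‖ ≤ D := by
      by_cases h1 : G δ = 0
      · exact hFD δ fun h2 => h ⟨h1, h2⟩
      · exact hGD δ h1
    exact mul_le_mul_of_nonneg_right ((norm_sub_le _ _).trans (by linarith)) (abs_nonneg _)

/-! ### The velocity as a barycentre of admissible displacements -/

/-- The density of the displacement at position `z` and time `t`, up to normalisation. -/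
noncomputable def weight (Ω : Set (Pt d)) (p₀ p₁ : Pt d → ℝ) (t : ℝ) (z δ : Pt d) : ℝ :=
  Ω.indicator p₀ (z - t • δ) * Ω.indicator p₁ (z + (1 - t) • δ)

theorem weight_of_mem {Ω : Set (Pt d)} {p₀ p₁ : Pt d → ℝ} {t : ℝ} {z δ : Pt d}
    (h : δ ∈ admissible Ω t z) :
    weight Ω p₀ p₁ t z δ = p₀ (z - t • δ) * p₁ (z + (1 - t) • δ) := by
  simp [weight, h.1, h.2]

theorem weight_of_notMem {Ω : Set (Pt d)} {p₀ p₁ : Pt d → ℝ} {t : ℝ} {z δ : Pt d}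
    (h : δ ∉ admissible Ω t z) : weight Ω p₀ p₁ t z δ = 0 := by
  by_cases h0 : z - t • δ ∈ Ω
  · have h1 : z + (1 - t) • δ ∉ Ω := fun h1 => h ⟨h0, h1⟩
    simp [weight, h1]
  · simp [weight, h0]

theorem weight_eq_indicator (Ω : Set (Pt d)) (p₀ p₁ : Pt d → ℝ) (t : ℝ) (z δ : Pt d) :
    weight Ω p₀ p₁ t z δ =
      (admissible Ω t z).indicator (fun δ => p₀ (z - t • δ) * p₁ (z + (1 - t) • δ)) δ := by
  by_cases h : δ ∈ admissible Ω t z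
  · rw [weight_of_mem h, indicator_of_mem h]
  · rw [weight_of_notMem h, indicator_of_notMem h]

theorem measurableSet_admissible {Ω : Set (Pt d)} (hΩ : MeasurableSet Ω) (t : ℝ) (z : Pt d) :
    MeasurableSet (admissible Ω t z) := by
  have m1 : Measurable fun δ : Pt d => z - t • δ := by fun_prop
  have m2 : Measurable fun δ : Pt d => z + (1 - t) • δ := by fun_prop
  exact (m1 hΩ).inter (m2 hΩ)

theorem isClosed_admissible {Ω : Set (Pt d)} (hΩ : IsClosed Ω) (t : ℝ) (z : Pt d) :
    IsClosed (admissible Ω t z) := by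
  have m1 : Continuous fun δ : Pt d => z - t • δ := by fun_prop
  have m2 : Continuous fun δ : Pt d => z + (1 - t) • δ := by fun_prop
  exact (hΩ.preimage m1).inter (hΩ.preimage m2)

theorem convex_admissible {Ω : Set (Pt d)} (hΩ : Convex ℝ Ω) (t : ℝ) (z : Pt d) :
    Convex ℝ (admissible Ω t z) := by
  intro a ha b hb r s hr hs hrs
  have e : z = r • z + s • z := by rw [← add_smul, hrs, one_smul]
  constructor
  · have := hΩ ha.1 hb.1 hr hs hrs
    convert this using 1
    nth_rewrite 1 [e]; module
  · have := hΩ ha.2 hb.2 hr hs hrs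
    convert this using 1
    nth_rewrite 1 [e]; module

theorem norm_le_of_mem_admissible {Ω : Set (Pt d)} (hΩ : Bornology.IsBounded Ω) {t : ℝ}
    {z δ : Pt d} (h : δ ∈ admissible Ω t z) : ‖δ‖ ≤ Metric.diam Ω := by
  have e : δ = (z + (1 - t) • δ) - (z - t • δ) := by module
  rw [e, ← dist_eq_norm]
  exact Metric.dist_le_diam_of_mem hΩ h.2 h.1

theorem closedBall_subset_admissible {Ω : Set (Pt d)} {z : Pt d} {ρ t : ℝ}
    (h : Metric.closedBall z ρ ⊆ Ω) (ht : t ∈ Icc (0 : ℝ) 1) :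
    Metric.closedBall 0 ρ ⊆ admissible Ω t z := by
  intro δ hδ
  rw [mem_closedBall_zero_iff] at hδ
  constructor
  · refine h ?_
    rw [mem_closedBall_iff_norm, sub_sub_cancel_left, norm_neg, norm_smul,
      Real.norm_of_nonneg ht.1]
    nlinarith [ht.1, ht.2, norm_nonneg δ]
  · refine h ?_
    rw [mem_closedBall_iff_norm, add_sub_cancel_left, norm_smul,
      Real.norm_of_nonneg (by linarith [ht.2])]
    nlinarith [ht.1, ht.2, norm_nonneg δ]

theorem isBounded_admissible {Ω : Set (Pt d)} (hΩ : Bornology.IsBounded Ω) (t : ℝ) (z : Pt d) :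
    Bornology.IsBounded (admissible Ω t z) :=
  isBounded_iff_forall_norm_le.2 ⟨Metric.diam Ω, fun _ h => norm_le_of_mem_admissible hΩ h⟩

theorem velocity_eq_mean {Ω : Set (Pt d)} (hΩ : MeasurableSet Ω) (p₀ p₁ : Pt d → ℝ) (t : ℝ)
    (z : Pt d) : velocity Ω p₀ p₁ t z =
      (∫ δ, weight Ω p₀ p₁ t z δ)⁻¹ • ∫ δ, weight Ω p₀ p₁ t z δ • δ := by
  unfold velocity
  rw [← integral_indicator (measurableSet_admissible hΩ t z),
    ← integral_indicator (measurableSet_admissible hΩ t z)]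
  congr 2
  · simp only [weight_eq_indicator]
  · ext1 δ
    rw [weight_eq_indicator]
    by_cases hδ : δ ∈ admissible Ω t z <;> simp [hδ]

theorem measurable_indicator_of_continuousOn {Ω : Set (Pt d)} (hΩ : MeasurableSet Ω)
    {p : Pt d → ℝ} (hp : ContinuousOn p Ω) : Measurable (Ω.indicator p) := by
  classical
  have := hp.measurable_piecewise (g := fun _ => (0 : ℝ)) continuousOn_const hΩ
  rwa [← Set.piecewise_eq_indicator]

section weights

variable {Ω : Set (Pt d)} {lo hi : ℝ} {p₀ p₁ : Pt d → ℝ}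

theorem weight_nonneg (hlo : 0 < lo) (hp₀ : IsWeightOn Ω lo hi p₀) (hp₁ : IsWeightOn Ω lo hi p₁)
    (t : ℝ) (z δ : Pt d) : 0 ≤ weight Ω p₀ p₁ t z δ :=
  mul_nonneg (indicator_nonneg (fun x hx => hlo.le.trans (hp₀.lower x hx)) _)
    (indicator_nonneg (fun x hx => hlo.le.trans (hp₁.lower x hx)) _)

theorem le_weight_of_mem (hlo : 0 < lo) (hp₀ : IsWeightOn Ω lo hi p₀)
    (hp₁ : IsWeightOn Ω lo hi p₁) {t : ℝ} {z δ : Pt d} (h : δ ∈ admissible Ω t z) :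
    lo ^ 2 ≤ weight Ω p₀ p₁ t z δ := by
  rw [weight_of_mem h, sq]
  exact mul_le_mul (hp₀.lower _ h.1) (hp₁.lower _ h.2) hlo.le (hlo.le.trans (hp₀.lower _ h.1))

theorem weight_le_of_mem (hlo : 0 < lo) (hp₀ : IsWeightOn Ω lo hi p₀)
    (hp₁ : IsWeightOn Ω lo hi p₁) {t : ℝ} {z δ : Pt d} (h : δ ∈ admissible Ω t z) :
    weight Ω p₀ p₁ t z δ ≤ hi ^ 2 := by
  rw [weight_of_mem h, sq]
  have h0 := hp₀.upper _ h.1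
  have h1 := hp₁.lower _ h.2
  exact mul_le_mul h0 (hp₁.upper _ h.2) (by linarith) (by linarith [hp₀.lower _ h.1])

theorem measurable_weight (hΩ : MeasurableSet Ω) (hp₀ : ContinuousOn p₀ Ω)
    (hp₁ : ContinuousOn p₁ Ω) :
    Measurable fun q : (ℝ × Pt d) × Pt d => weight Ω p₀ p₁ q.1.1 q.1.2 q.2 := by
  have h0 := measurable_indicator_of_continuousOn hΩ hp₀
  have h1 := measurable_indicator_of_continuousOn hΩ hp₁
  unfold weight
  fun_prop

theorem integrable_weight (hΩ : IsCompact Ω) (hlo : 0 < lo) (hp₀ : IsWeightOn Ω lo hi p₀)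
    (hp₁ : IsWeightOn Ω lo hi p₁) (t : ℝ) (z : Pt d) : Integrable (weight Ω p₀ p₁ t z) := by
  have hS := measurableSet_admissible hΩ.measurableSet t z
  have hfin := (isBounded_admissible hΩ.isBounded t z).measure_lt_top (μ := volume)
  have hm : Measurable (weight Ω p₀ p₁ t z) :=
    (measurable_weight hΩ.measurableSet hp₀.continuousOn hp₁.continuousOn).comp
      (measurable_prodMk_left (x := (t, z)))
  have hi1 : Integrable ((admissible Ω t z).indicator fun _ => hi ^ 2) :=
    (integrable_indicator_iff hS).2 (integrableOn_const hfin.ne)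
  refine hi1.mono' hm.aestronglyMeasurable (Eventually.of_forall fun δ => ?_)
  rw [Real.norm_of_nonneg (weight_nonneg hlo hp₀ hp₁ t z δ)]
  by_cases h : δ ∈ admissible Ω t z
  · rw [indicator_of_mem h]; exact weight_le_of_mem hlo hp₀ hp₁ h
  · rw [indicator_of_notMem h, weight_of_notMem h]

theorem mul_volume_le_integral_weight (hΩ : IsCompact Ω) (hlo : 0 < lo)
    (hp₀ : IsWeightOn Ω lo hi p₀) (hp₁ : IsWeightOn Ω lo hi p₁) (t : ℝ) (z : Pt d) :
    lo ^ 2 * volume.real (admissible Ω t z) ≤ ∫ δ, weight Ω p₀ p₁ t z δ := by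
  have hS := measurableSet_admissible hΩ.measurableSet t z
  have hfin := (isBounded_admissible hΩ.isBounded t z).measure_lt_top (μ := volume)
  have e : lo ^ 2 * volume.real (admissible Ω t z)
      = ∫ δ, (admissible Ω t z).indicator (fun _ => lo ^ 2) δ := by
    rw [integral_indicator hS, setIntegral_const, smul_eq_mul, mul_comm]
  rw [e]
  refine integral_mono ((integrable_indicator_iff hS).2 (integrableOn_const hfin.ne))
    (integrable_weight hΩ hlo hp₀ hp₁ t z) fun δ => ?_
  by_cases h : δ ∈ admissible Ω t z
  · simp only [indicator_of_mem h]; exact le_weight_of_mem hlo hp₀ hp₁ h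
  · simp only [indicator_of_notMem h, weight_of_notMem h, le_refl]

theorem volume_admissible_pos (hΩ : IsCompact Ω) {t : ℝ} (ht : t ∈ Icc (0 : ℝ) 1) {z : Pt d}
    (hz : z ∈ interior Ω) : 0 < volume.real (admissible Ω t z) := by
  obtain ⟨ρ, hρ, hb⟩ := Metric.nhds_basis_closedBall.mem_iff.1 (mem_interior_iff_mem_nhds.1 hz)
  have hfin := (isBounded_admissible hΩ.isBounded t z).measure_lt_top (μ := volume)
  refine ENNReal.toReal_pos ?_ hfin.ne
  exact ((Metric.measure_closedBall_pos volume 0 hρ).trans_le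
    (measure_mono (closedBall_subset_admissible hb ht))).ne'

theorem integral_weight_pos (hΩ : IsCompact Ω) (hlo : 0 < lo)
    (hp₀ : IsWeightOn Ω lo hi p₀) (hp₁ : IsWeightOn Ω lo hi p₁) {t : ℝ} (ht : t ∈ Icc (0 : ℝ) 1)
    {z : Pt d} (hz : z ∈ interior Ω) : 0 < ∫ δ, weight Ω p₀ p₁ t z δ :=
  (mul_pos (pow_pos hlo 2) (volume_admissible_pos hΩ ht hz)).trans_le
    (mul_volume_le_integral_weight hΩ hlo hp₀ hp₁ t z)

theorem norm_le_of_weight_ne_zero (hΩ : IsCompact Ω) {t : ℝ} {z δ : Pt d}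
    (h : weight Ω p₀ p₁ t z δ ≠ 0) : ‖δ‖ ≤ Metric.diam Ω :=
  norm_le_of_mem_admissible hΩ.isBounded (by
    by_contra hcon
    exact h (weight_of_notMem hcon))

theorem norm_velocity_le (hΩ : IsCompact Ω) (hlo : 0 < lo) (hp₀ : IsWeightOn Ω lo hi p₀)
    (hp₁ : IsWeightOn Ω lo hi p₁) (t : ℝ) (z : Pt d) :
    ‖velocity Ω p₀ p₁ t z‖ ≤ Metric.diam Ω := by
  rw [velocity_eq_mean hΩ.measurableSet]
  exact norm_mean_le Metric.diam_nonneg (weight_nonneg hlo hp₀ hp₁ t z)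
    fun δ h => norm_le_of_weight_ne_zero hΩ h

theorem measurable_velocity (hΩ : MeasurableSet Ω) (hp₀ : ContinuousOn p₀ Ω)
    (hp₁ : ContinuousOn p₁ Ω) :
    Measurable fun q : ℝ × Pt d => velocity Ω p₀ p₁ q.1 q.2 := by
  have mh := measurable_weight hΩ hp₀ hp₁
  have mden : StronglyMeasurable fun q : ℝ × Pt d => ∫ δ, weight Ω p₀ p₁ q.1 q.2 δ :=
    StronglyMeasurable.integral_prod_right
      (f := fun (q : ℝ × Pt d) (δ : Pt d) => weight Ω p₀ p₁ q.1 q.2 δ) mh.stronglyMeasurable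
  have mnum : StronglyMeasurable fun q : ℝ × Pt d => ∫ δ, weight Ω p₀ p₁ q.1 q.2 δ • δ :=
    StronglyMeasurable.integral_prod_right
      (f := fun (q : ℝ × Pt d) (δ : Pt d) => weight Ω p₀ p₁ q.1 q.2 δ • δ)
      (mh.smul measurable_snd).stronglyMeasurable
  have : (fun q : ℝ × Pt d => velocity Ω p₀ p₁ q.1 q.2) = fun q =>
      (∫ δ, weight Ω p₀ p₁ q.1 q.2 δ)⁻¹ • ∫ δ, weight Ω p₀ p₁ q.1 q.2 δ • δ :=
    funext fun q => velocity_eq_mean hΩ p₀ p₁ q.1 q.2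
  rw [this]
  exact mden.measurable.inv.smul mnum.measurable

/-- The velocity is an average of admissible displacements, hence admissible. -/
theorem velocity_mem_admissible (hΩ : IsCompact Ω) (hc : Convex ℝ Ω) (hlo : 0 < lo)
    (hp₀ : IsWeightOn Ω lo hi p₀) (hp₁ : IsWeightOn Ω lo hi p₁) {t : ℝ}
    (ht : t ∈ Icc (0 : ℝ) 1) {z : Pt d} (hz : z ∈ interior Ω) :
    velocity Ω p₀ p₁ t z ∈ admissible Ω t z := by
  have hw := integrable_weight hΩ hlo hp₀ hp₁ t z
  have hpos := integral_weight_pos hΩ hlo hp₀ hp₁ ht hz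
  have h0 := weight_nonneg hlo hp₀ hp₁ t z
  have hm : Measurable (weight Ω p₀ p₁ t z) :=
    (measurable_weight hΩ.measurableSet hp₀.continuousOn hp₁.continuousOn).comp
      (measurable_prodMk_left (x := (t, z)))
  set N := ∫ δ, weight Ω p₀ p₁ t z δ with hN
  let f : Pt d → ℝ := fun δ => N⁻¹ * weight Ω p₀ p₁ t z δ
  have hf0 : ∀ δ, 0 ≤ f δ := fun δ => mul_nonneg (inv_nonneg.2 hpos.le) (h0 δ)
  have hfm : Measurable f := hm.const_mul _
  let μ : Measure (Pt d) := volume.withDensity fun δ => ENNReal.ofReal (f δ)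
  have hμ : IsProbabilityMeasure μ := by
    constructor
    rw [withDensity_apply _ MeasurableSet.univ, Measure.restrict_univ,
      ← ofReal_integral_eq_lintegral_ofReal (hw.const_mul _) (Eventually.of_forall hf0),
      integral_const_mul, ← hN, inv_mul_cancel₀ hpos.ne', ENNReal.ofReal_one]
  have hae : ∀ᵐ δ ∂μ, δ ∈ admissible Ω t z := by
    rw [ae_withDensity_iff (by fun_prop)]
    refine Eventually.of_forall fun δ hδ => ?_
    by_contra hcon
    exact hδ (by simp [f, weight_of_notMem hcon])
  have hint : Integrable (fun δ : Pt d => δ) μ :=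
    Integrable.of_bound aestronglyMeasurable_id (Metric.diam Ω)
      (hae.mono fun δ h => norm_le_of_mem_admissible hΩ.isBounded h)
  have := (convex_admissible hc t z).integral_mem (isClosed_admissible hΩ.isClosed t z) hae hint
  convert this using 1
  rw [velocity_eq_mean hΩ.measurableSet, ← hN, ← integral_smul,
    integral_withDensity_eq_integral_toReal_smul (by fun_prop)
      (Eventually.of_forall fun _ => by simp)]
  congr 1
  ext1 δ
  rw [ENNReal.toReal_ofReal (hf0 δ), smul_smul]

end weights

/-! ### The ratio modulus -/

section modulus

variable {Ω : Set (Pt d)} {lo hi : ℝ} {p₀ p₁ : Pt d → ℝ}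

theorem abs_div_sub_one_le (hlo : 0 < lo) {p : Pt d → ℝ} (hlower : ∀ x ∈ Ω, lo ≤ p x)
    (hupper : ∀ x ∈ Ω, p x ≤ hi) {z z' : Pt d} (hz : z ∈ Ω) (hz' : z' ∈ Ω) :
    |p z / p z' - 1| ≤ hi / lo := by
  have h1 := hlower z hz
  have h2 := hlower z' hz'
  have h3 := hupper z hz
  have h4 : 0 < p z' := hlo.trans_le h2
  have h5 : p z / p z' ≤ hi / lo := div_le_div₀ (by linarith) h3 hlo h2
  have h6 : 0 ≤ p z / p z' := div_nonneg (by linarith) h4.le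
  have h7 : 1 ≤ hi / lo := by rw [one_le_div hlo]; linarith
  rw [abs_le]; constructor <;> linarith

theorem bddAbove_ratio (hlo : 0 < lo) (hl₀ : ∀ x ∈ Ω, lo ≤ p₀ x) (hu₀ : ∀ x ∈ Ω, p₀ x ≤ hi)
    (hl₁ : ∀ x ∈ Ω, lo ≤ p₁ x) (hu₁ : ∀ x ∈ Ω, p₁ x ≤ hi) (η : ℝ) :
    BddAbove {r | ∃ z ∈ Ω, ∃ z' ∈ Ω, ‖z - z'‖ ≤ η ∧
      r = max |p₀ z / p₀ z' - 1| |p₁ z / p₁ z' - 1|} := by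
  refine ⟨hi / lo, ?_⟩
  rintro r ⟨z, hz, z', hz', -, rfl⟩
  exact max_le (abs_div_sub_one_le hlo hl₀ hu₀ hz hz') (abs_div_sub_one_le hlo hl₁ hu₁ hz hz')

theorem ratioModulus_nonneg (Ω : Set (Pt d)) (p₀ p₁ : Pt d → ℝ) (η : ℝ) :
    0 ≤ ratioModulus Ω p₀ p₁ η := by
  refine Real.sSup_nonneg ?_
  rintro r ⟨z, hz, z', hz', -, rfl⟩
  exact (abs_nonneg _).trans (le_max_left _ _)

/-- Two-sided bounds on a pair of positive functions, without regularity. -/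
structure IsBoundedPair (Ω : Set (Pt d)) (lo hi : ℝ) (p₀ p₁ : Pt d → ℝ) : Prop where
  lower₀ : ∀ x ∈ Ω, lo ≤ p₀ x
  upper₀ : ∀ x ∈ Ω, p₀ x ≤ hi
  lower₁ : ∀ x ∈ Ω, lo ≤ p₁ x
  upper₁ : ∀ x ∈ Ω, p₁ x ≤ hi

theorem IsWeightOn.isBoundedPair (hp₀ : IsWeightOn Ω lo hi p₀) (hp₁ : IsWeightOn Ω lo hi p₁) :
    IsBoundedPair Ω lo hi p₀ p₁ :=
  ⟨hp₀.lower, hp₀.upper, hp₁.lower, hp₁.upper⟩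

theorem IsBoundedPair.le_ratioModulus (h : IsBoundedPair Ω lo hi p₀ p₁) (hlo : 0 < lo)
    {z z' : Pt d} (hz : z ∈ Ω) (hz' : z' ∈ Ω) {η : ℝ} (hη : ‖z - z'‖ ≤ η) :
    |p₀ z / p₀ z' - 1| ≤ ratioModulus Ω p₀ p₁ η ∧
      |p₁ z / p₁ z' - 1| ≤ ratioModulus Ω p₀ p₁ η := by
  have := le_csSup (bddAbove_ratio hlo h.lower₀ h.upper₀ h.lower₁ h.upper₁ η)
    ⟨z, hz, z', hz', hη, rfl⟩
  exact ⟨(le_max_left _ _).trans this, (le_max_right _ _).trans this⟩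

theorem ratioModulus_le {η M : ℝ} (hM : 0 ≤ M)
    (h : ∀ z ∈ Ω, ∀ z' ∈ Ω, ‖z - z'‖ ≤ η → |p₀ z / p₀ z' - 1| ≤ M ∧ |p₁ z / p₁ z' - 1| ≤ M) :
    ratioModulus Ω p₀ p₁ η ≤ M := by
  refine Real.sSup_le ?_ hM
  rintro r ⟨z, hz, z', hz', hη, rfl⟩
  exact max_le (h z hz z' hz' hη).1 (h z hz z' hz' hη).2

theorem IsBoundedPair.monotone_ratioModulus (h : IsBoundedPair Ω lo hi p₀ p₁) (hlo : 0 < lo) :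
    Monotone (ratioModulus Ω p₀ p₁) := fun _ _ hab =>
  ratioModulus_le (ratioModulus_nonneg _ _ _ _) fun _ hz _ hz' hη =>
    h.le_ratioModulus hlo hz hz' (hη.trans hab)

theorem IsBoundedPair.ratioModulus_le_div (h : IsBoundedPair Ω lo hi p₀ p₁) (hlo : 0 < lo)
    (hne : Ω.Nonempty) (η : ℝ) : ratioModulus Ω p₀ p₁ η ≤ hi / lo := by
  obtain ⟨x, hx⟩ := hne
  have h1 := h.lower₀ x hx
  have h2 := h.upper₀ x hx
  exact ratioModulus_le (div_nonneg (by linarith) hlo.le) fun _ hz _ hz' _ =>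
    ⟨abs_div_sub_one_le hlo h.lower₀ h.upper₀ hz hz', abs_div_sub_one_le hlo h.lower₁ h.upper₁ hz hz'⟩

theorem abs_mul_sub_one_le {r s a b : ℝ} (hr : |r - 1| ≤ a) (hs : |s - 1| ≤ b) :
    |r * s - 1| ≤ (1 + a) * (1 + b) - 1 := by
  have e : r * s - 1 = (r - 1) * (s - 1) + (r - 1) + (s - 1) := by ring
  rw [e]
  have ha : 0 ≤ a := (abs_nonneg _).trans hr
  have h1 : |(r - 1) * (s - 1)| ≤ a * b := by
    rw [abs_mul]; exact mul_le_mul hr hs (abs_nonneg _) ha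
  have h2 := abs_add_three ((r - 1) * (s - 1)) (r - 1) (s - 1)
  linarith

/-- By convexity the segment from z to z' can be divided in the proportion a : b at a point of Ω,
and the ratios of the two pieces multiply. This submultiplicativity of 1 + ω is the source of the
continuity of ω on (0,∞). -/
theorem IsBoundedPair.ratioModulus_add_le (h : IsBoundedPair Ω lo hi p₀ p₁) (hlo : 0 < lo)
    (hc : Convex ℝ Ω) {a b : ℝ} (ha : 0 < a) (hb : 0 ≤ b) :
    ratioModulus Ω p₀ p₁ (a + b) ≤
      (1 + ratioModulus Ω p₀ p₁ a) * (1 + ratioModulus Ω p₀ p₁ b) - 1 := by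
  have na := ratioModulus_nonneg Ω p₀ p₁ a
  have nb := ratioModulus_nonneg Ω p₀ p₁ b
  refine ratioModulus_le (by nlinarith) fun z hz z' hz' hη => ?_
  have hab : 0 < a + b := by linarith
  set w := (b / (a + b)) • z + (a / (a + b)) • z' with hw
  have hwΩ : w ∈ Ω := hc hz hz' (by positivity) (by positivity) (by field_simp; ring)
  have e1 : z - w = (a / (a + b)) • (z - z') := by
    have : (1 : ℝ) = b / (a + b) + a / (a + b) := by field_simp; ring
    have e : z = (b / (a + b) + a / (a + b)) • z := by rw [← this, one_smul]
    rw [hw]; nth_rewrite 1 [e]; module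
  have e2 : w - z' = (b / (a + b)) • (z - z') := by
    have : (1 : ℝ) = b / (a + b) + a / (a + b) := by field_simp; ring
    have e : z' = (b / (a + b) + a / (a + b)) • z' := by rw [← this, one_smul]
    rw [hw]; nth_rewrite 2 [e]; module
  have n1 : ‖z - w‖ ≤ a := by
    rw [e1, norm_smul, Real.norm_of_nonneg (by positivity), div_mul_eq_mul_div, div_le_iff₀ hab]
    exact mul_le_mul_of_nonneg_left hη ha.le
  have n2 : ‖w - z'‖ ≤ b := by
    rw [e2, norm_smul, Real.norm_of_nonneg (by positivity), div_mul_eq_mul_div, div_le_iff₀ hab]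
    exact mul_le_mul_of_nonneg_left hη hb
  have m1 := h.le_ratioModulus hlo hz hwΩ n1
  have m2 := h.le_ratioModulus hlo hwΩ hz' n2
  have w0 : p₀ w ≠ 0 := (hlo.trans_le (h.lower₀ w hwΩ)).ne'
  have w1 : p₁ w ≠ 0 := (hlo.trans_le (h.lower₁ w hwΩ)).ne'
  have q0 : p₀ z / p₀ z' = p₀ z / p₀ w * (p₀ w / p₀ z') := by field_simp
  have q1 : p₁ z / p₁ z' = p₁ z / p₁ w * (p₁ w / p₁ z') := by field_simp
  rw [q0, q1]
  exact ⟨abs_mul_sub_one_le m1.1 m2.1, abs_mul_sub_one_le m1.2 m2.2⟩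

end modulus

/-! ### Osgood moduli -/

/-- The properties of a modulus `ω` used in the Osgood argument. -/
structure IsOsgoodModulus (ω : ℝ → ℝ) : Prop where
  nonneg : ∀ u, 0 ≤ ω u
  mono : Monotone ω
  continuousOn : ContinuousOn ω (Ioi 0)
  bounded : ∃ M, ∀ u, ω u ≤ M
  osgood : IsOsgood ω

/-- If ω stayed above some c > 0 on (0,∞), the integrand 1/(s+ω(s)) would be at most 1/c and Ψ would
be bounded below on (0,1). Monotonicity turns one small value into a limit. -/
theorem IsOsgood.tendsto_zero {ω : ℝ → ℝ} (h : IsOsgood ω) (hω : Monotone ω)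
    (h0 : ∀ u, 0 ≤ ω u) : Tendsto ω (𝓝[>] 0) (𝓝 0) := by
  have key : ∀ c > 0, ∃ s > 0, ω s < c := by
    intro c hc
    by_contra! hcon
    obtain ⟨u, hu, hu1, hu0⟩ := ((h.eventually (eventually_lt_atBot (-(1 / c)))).and
      (Ioo_mem_nhdsGT (zero_lt_one' ℝ))).exists
    have hle : ∫ s in u..1, 1 / (s + ω s) ≤ ∫ s in u..1, 1 / c := by
      refine intervalIntegral.integral_mono_on hu0.le ?_ (by simp) fun s hs => ?_
      · refine AntitoneOn.intervalIntegrable ?_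
        rw [uIcc_of_le hu0.le]
        intro a ha b hb hab
        have : 0 < a := hu1.trans_le ha.1
        exact one_div_le_one_div_of_le (by linarith [h0 a]) (by linarith [hω hab])
      · have : 0 < s := hu1.trans_le hs.1
        exact one_div_le_one_div_of_le hc (by linarith [hcon s this])
    rw [psiReal, intervalIntegral.integral_symm] at hu
    rw [intervalIntegral.integral_const, smul_eq_mul] at hle
    have : (1 - u) * (1 / c) ≤ 1 / c := mul_le_of_le_one_left (by positivity) (by linarith)
    linarith
  rw [Metric.tendsto_nhds]
  intro c hc
  obtain ⟨s, hs, hsc⟩ := key c hc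
  filter_upwards [Ioo_mem_nhdsGT hs] with u hu
  rw [Real.dist_eq, sub_zero, abs_of_nonneg (h0 u)]
  exact (hω hu.2.le).trans_lt hsc

/-- Continuity is the point: submultiplicativity and ω ≤ hi/lo give ω(b) - ω(a) ≤ (1 + hi/lo)
ω(b-a), and ω tends to 0 at 0. It makes Ψ differentiable. -/
theorem IsBoundedPair.isOsgoodModulus {Ω : Set (Pt d)} {lo hi : ℝ} {p₀ p₁ : Pt d → ℝ}
    (h : IsBoundedPair Ω lo hi p₀ p₁) (hlo : 0 < lo) (hc : Convex ℝ Ω) (hne : Ω.Nonempty)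
    (ho : IsOsgood (ratioModulus Ω p₀ p₁)) : IsOsgoodModulus (ratioModulus Ω p₀ p₁) := by
  have hm := h.monotone_ratioModulus hlo
  have h0 := ratioModulus_nonneg Ω p₀ p₁
  have hM := h.ratioModulus_le_div hlo hne
  refine ⟨h0, hm, ?_, ⟨hi / lo, hM⟩, ho⟩
  set ω := ratioModulus Ω p₀ p₁
  have ht := ho.tendsto_zero hm h0
  have key : ∀ a b, 0 < a → a ≤ b → ω b - ω a ≤ (1 + hi / lo) * ω (b - a) := by
    intro a b ha hab
    have := h.ratioModulus_add_le hlo hc ha (sub_nonneg.2 hab)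
    rw [add_sub_cancel] at this
    have h1 : ω a * ω (b - a) ≤ hi / lo * ω (b - a) :=
      mul_le_mul_of_nonneg_right (hM a) (h0 _)
    change ω b ≤ (1 + ω a) * (1 + ω (b - a)) - 1 at this
    nlinarith
  have h1 : 0 < 1 + hi / lo := by linarith [h0 0, hM 0]
  intro a (ha : 0 < a)
  refine ContinuousAt.continuousWithinAt ?_
  rw [Metric.continuousAt_iff]
  intro c hcpos
  have hs : ∀ᶠ u in 𝓝[>] 0, ω u < c / (1 + hi / lo) := ht.eventually_lt_const (by positivity)
  obtain ⟨s, hs, hs0⟩ := (hs.and self_mem_nhdsWithin).exists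
  have hs0 : 0 < s := hs0
  have hs' : (1 + hi / lo) * ω s < c := by rwa [lt_div_iff₀' h1] at hs
  refine ⟨min a s, lt_min ha hs0, fun {b} hb => ?_⟩
  rw [Real.dist_eq, abs_lt] at hb
  have hb1 := min_le_left a s
  have hb2 := min_le_right a s
  have hb0 : 0 < b := by linarith [hb.1]
  rw [Real.dist_eq]
  rcases le_total a b with hab | hab
  · have k := key a b ha hab
    rw [abs_of_nonneg (sub_nonneg.2 (hm hab))]
    have : ω (b - a) ≤ ω s := hm (by linarith [hb.2])
    nlinarith
  · have k := key b a hb0 hab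
    rw [abs_sub_comm, abs_of_nonneg (sub_nonneg.2 (hm hab))]
    have : ω (a - b) ≤ ω s := hm (by linarith [hb.1])
    nlinarith

/-- Functions whose ratio modulus satisfies the Osgood condition are continuous. -/
theorem IsBoundedPair.continuousOn {Ω : Set (Pt d)} {lo hi : ℝ} {p₀ p₁ : Pt d → ℝ}
    (h : IsBoundedPair Ω lo hi p₀ p₁) (hlo : 0 < lo) (ho : IsOsgood (ratioModulus Ω p₀ p₁)) :
    ContinuousOn p₀ Ω ∧ ContinuousOn p₁ Ω := by
  have hm := h.monotone_ratioModulus hlo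
  have h0 := ratioModulus_nonneg Ω p₀ p₁
  have ht := ho.tendsto_zero hm h0
  have key : ∀ p : Pt d → ℝ, (∀ x ∈ Ω, lo ≤ p x) →
      (∀ z ∈ Ω, ∀ z' ∈ Ω, |p z / p z' - 1| ≤ ratioModulus Ω p₀ p₁ ‖z - z'‖) →
      ContinuousOn p Ω := by
    intro p hl hr a ha
    have hpa : 0 < p a := hlo.trans_le (hl a ha)
    rw [Metric.continuousWithinAt_iff]
    intro c hcpos
    obtain ⟨s, hs, hs0⟩ := ((ht.eventually_lt_const (u := c / p a) (by positivity)).and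
      self_mem_nhdsWithin).exists
    refine ⟨s, hs0, fun {b} hb hbs => ?_⟩
    have h1 := hr b hb a ha
    rw [dist_eq_norm] at hbs
    have h2 : |p b / p a - 1| < c / p a := (h1.trans (hm hbs.le)).trans_lt hs
    have e : p b - p a = (p b / p a - 1) * p a := by field_simp
    rw [Real.dist_eq, e, abs_mul, abs_of_pos hpa]
    rwa [lt_div_iff₀ hpa] at h2
  exact ⟨key p₀ h.lower₀ fun z hz z' hz' => (h.le_ratioModulus hlo hz hz' le_rfl).1,
    key p₁ h.lower₁ fun z hz z' hz' => (h.le_ratioModulus hlo hz hz' le_rfl).2⟩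

/-! ### The Osgood inequality and the inverse of Ψ -/

section osgood

variable {ω : ℝ → ℝ}

theorem IsOsgoodModulus.continuousOn_inv (h : IsOsgoodModulus ω) :
    ContinuousOn (fun s => 1 / (s + ω s)) (Ioi 0) := by
  refine continuousOn_const.div (continuousOn_id.add h.continuousOn) fun s hs => ?_
  have : 0 < s := hs
  exact (add_pos_of_pos_of_nonneg this (h.nonneg s)).ne'

theorem IsOsgoodModulus.intervalIntegrable (h : IsOsgoodModulus ω) {a b : ℝ} (ha : 0 < a)
    (hb : 0 < b) : IntervalIntegrable (fun s => 1 / (s + ω s)) volume a b :=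
  (h.continuousOn_inv.mono fun _ hs => (lt_min ha hb).trans_le hs.1).intervalIntegrable

theorem IsOsgoodModulus.psiReal_sub (h : IsOsgoodModulus ω) {a b : ℝ} (ha : 0 < a)
    (hb : 0 < b) : psiReal ω b - psiReal ω a = ∫ s in a..b, 1 / (s + ω s) := by
  rw [psiReal, psiReal, intervalIntegral.integral_interval_sub_left
    (h.intervalIntegrable one_pos hb) (h.intervalIntegrable one_pos ha)]

theorem IsOsgoodModulus.hasDerivAt_psiReal (h : IsOsgoodModulus ω) {a : ℝ} (ha : 0 < a) :
    HasDerivAt (psiReal ω) (1 / (a + ω a)) a :=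
  intervalIntegral.integral_hasDerivAt_right (h.intervalIntegrable one_pos ha)
    (h.continuousOn_inv.stronglyMeasurableAtFilter isOpen_Ioi a ha)
    (h.continuousOn_inv.continuousAt (Ioi_mem_nhds ha))

theorem IsOsgoodModulus.strictMonoOn_psiReal (h : IsOsgoodModulus ω) :
    StrictMonoOn (psiReal ω) (Ioi 0) := by
  intro a ha b hb hab
  rw [← sub_pos, h.psiReal_sub ha hb]
  refine intervalIntegral.intervalIntegral_pos_of_pos_on (h.intervalIntegrable ha hb) ?_ hab
  intro s hs
  have : 0 < s := lt_trans ha hs.1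
  exact one_div_pos.2 (add_pos_of_pos_of_nonneg this (h.nonneg s))

/-- Integrates 1/s ≤ (L+1)/(s+ω(s)); it turns the bound through Ψ into the exponential one. -/
theorem IsOsgoodModulus.log_div_le (h : IsOsgoodModulus ω) {L : ℝ}
    (hL : ∀ u, 0 ≤ u → ω u ≤ L * u) {a b : ℝ} (ha : 0 < a) (hab : a ≤ b) :
    Real.log (b / a) ≤ (L + 1) * (psiReal ω b - psiReal ω a) := by
  have hb : 0 < b := ha.trans_le hab
  have hL0 : 0 ≤ L := by have := hL 1 zero_le_one; linarith [h.nonneg 1]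
  rw [h.psiReal_sub ha hb, ← integral_one_div_of_pos ha hb, ← intervalIntegral.integral_const_mul]
  refine intervalIntegral.integral_mono_on hab ?_ ((h.intervalIntegrable ha hb).const_mul _) ?_
  · exact intervalIntegral.intervalIntegrable_one_div (fun x hx => by
      rw [uIcc_of_le hab] at hx; exact (ha.trans_le hx.1).ne') continuousOn_id
  · intro s hs
    have hs0 : 0 < s := ha.trans_le hs.1
    have h1 := hL s hs0.le
    have h2 : 0 < s + ω s := add_pos_of_pos_of_nonneg hs0 (h.nonneg s)
    rw [mul_one_div, div_le_div_iff₀ hs0 h2]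
    linarith

/-- A bound M on ω gives 1/(s+ω(s)) ≥ 1/((1+M)s) for s ≥ 1. Without this growth the set whose
supremum defines `psiInv` could be unbounded, and its `sSup` would be the default value 0. -/
theorem IsOsgoodModulus.tendsto_psiReal_atTop (h : IsOsgoodModulus ω) :
    Tendsto (psiReal ω) atTop atTop := by
  obtain ⟨M, hM⟩ := h.bounded
  have hM0 : 0 ≤ M := (h.nonneg 0).trans (hM 0)
  have hlog : Tendsto (fun u => (1 + M)⁻¹ * Real.log u) atTop atTop :=
    Real.tendsto_log_atTop.const_mul_atTop (by positivity)
  refine tendsto_atTop_mono' _ ?_ hlog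
  filter_upwards [eventually_ge_atTop 1] with u hu
  have hu0 : 0 < u := by linarith
  rw [psiReal, show Real.log u = Real.log (u / 1) by simp, ← integral_one_div_of_pos one_pos hu0,
    ← intervalIntegral.integral_const_mul]
  refine intervalIntegral.integral_mono_on hu ?_ (h.intervalIntegrable one_pos hu0) ?_
  · refine IntervalIntegrable.const_mul ?_ _
    exact intervalIntegral.intervalIntegrable_one_div (fun x hx => by
      rw [uIcc_of_le hu] at hx; exact (one_pos.trans_le hx.1).ne') continuousOn_id
  · intro s hs
    have hs1 := hs.1
    have hs0 : 0 < s := by linarith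
    have h2 : 0 < s + ω s := add_pos_of_pos_of_nonneg hs0 (h.nonneg s)
    rw [inv_mul_eq_div, div_div, div_le_div_iff₀ (by positivity) h2]
    nlinarith [hM s]

/-- The Osgood inequality. -/
theorem IsOsgoodModulus.psiReal_le (h : IsOsgoodModulus ω) {u : ℝ → ℝ} {a K B T : ℝ} (ha : 0 < a)
    (hK : 0 ≤ K) (hu : Measurable u) (hu0 : ∀ t, 0 ≤ u t) (huB : ∀ t, u t ≤ B)
    (hle : ∀ t ∈ Icc 0 T, u t ≤ a + ∫ s in (0 : ℝ)..t, K * (u s + ω (u s)))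
    {t : ℝ} (ht : t ∈ Icc 0 T) (hpos : 0 < u t) :
    psiReal ω (u t) ≤ psiReal ω a + K * t := by
  obtain ⟨M, hM⟩ := h.bounded
  have hm : Measurable fun s => K * (u s + ω (u s)) :=
    (hu.add (h.mono.measurable.comp hu)).const_mul K
  have hnn : ∀ s, 0 ≤ K * (u s + ω (u s)) := fun s =>
    mul_nonneg hK (add_nonneg (hu0 s) (h.nonneg _))
  have hint : ∀ a b, IntervalIntegrable (fun s => K * (u s + ω (u s))) volume a b := by
    intro a b
    refine (intervalIntegrable_const (c := K * (B + M))).mono_fun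
      hm.aestronglyMeasurable (Eventually.of_forall fun s => ?_)
    have h1 : K * (u s + ω (u s)) ≤ K * (B + M) :=
      mul_le_mul_of_nonneg_left (add_le_add (huB s) (hM _)) hK
    simp only
    rw [Real.norm_of_nonneg (hnn s), Real.norm_of_nonneg ((hnn s).trans h1)]
    exact h1
  -- Since u is only measurable, it is replaced by majorants u ≤ G ≤ H: G is continuous, and H,
  -- built from G in the same way, is differentiable. Starting from a > 0 keeps both away from 0,
  -- where ω need not be continuous.
  set G : ℝ → ℝ := fun t => a + ∫ s in (0 : ℝ)..t, K * (u s + ω (u s)) with hG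
  have hGc : Continuous G := by
    refine continuous_const.add ?_
    exact intervalIntegral.continuous_primitive hint 0
  have hGa : ∀ t, 0 ≤ t → a ≤ G t := fun t ht => by
    have : 0 ≤ ∫ s in (0 : ℝ)..t, K * (u s + ω (u s)) :=
      intervalIntegral.integral_nonneg ht fun s _ => hnn s
    simp only [hG]; linarith
  have hΦG : ContinuousOn (fun s => K * (G s + ω (G s))) (Ici 0) := by
    refine continuousOn_const.mul (hGc.continuousOn.add (h.continuousOn.comp hGc.continuousOn ?_))
    intro s hs
    exact ha.trans_le (hGa s hs)
  -- For negative times G may fall below a, so it is frozen there; the integrand of H is then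
  -- continuous on the whole line.
  set G' : ℝ → ℝ := fun s => G (max s 0) with hG'
  have hG'c : Continuous fun s => K * (G' s + ω (G' s)) :=
    hΦG.comp_continuous (continuous_id.max continuous_const) fun s => le_max_right s 0
  set H : ℝ → ℝ := fun t => a + ∫ s in (0 : ℝ)..t, K * (G' s + ω (G' s)) with hH
  have hHd : ∀ t, HasDerivAt H (K * (G' t + ω (G' t))) t := fun t =>
    (intervalIntegral.integral_hasDerivAt_right (hG'c.intervalIntegrable 0 t)
      (hG'c.stronglyMeasurableAtFilter _ _) hG'c.continuousAt).const_add a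
  have hGH : ∀ t ∈ Icc 0 T, G t ≤ H t := by
    intro t ht
    simp only [hG, hH]
    refine add_le_add_right (intervalIntegral.integral_mono_on ht.1 (hint 0 t)
      (hG'c.intervalIntegrable 0 t) fun s hs => ?_) _
    have h1 : u s ≤ G' s := by
      simp only [hG', max_eq_left hs.1]
      exact hle s ⟨hs.1, hs.2.trans ht.2⟩
    exact mul_le_mul_of_nonneg_left (add_le_add h1 (h.mono h1)) hK
  have hHpos : ∀ t ∈ Icc 0 T, 0 < H t := fun t ht =>
    ha.trans_le ((hGa t ht.1).trans (hGH t ht))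
  have hd : ∀ s ∈ Icc 0 T, HasDerivAt (fun s => psiReal ω (H s) - K * s)
      (1 / (H s + ω (H s)) * (K * (G' s + ω (G' s))) - K) s := by
    intro s hs
    have := ((h.hasDerivAt_psiReal (hHpos s hs)).comp s (hHd s)).sub
      ((hasDerivAt_id s).const_mul K)
    rw [mul_one] at this
    exact this
  -- H' = K(G+ω(G)) ≤ K(H+ω(H)) because ω is monotone, so the derivative of Ψ(H) is at most K.
  have hanti : AntitoneOn (fun s => psiReal ω (H s) - K * s) (Icc 0 T) := by
    refine antitoneOn_of_deriv_nonpos (convex_Icc 0 T)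
      (fun s hs => (hd s hs).continuousAt.continuousWithinAt)
      (fun s hs => (hd s (interior_subset hs)).differentiableAt.differentiableWithinAt)
      fun s hs => ?_
    have hs' := interior_subset hs
    rw [(hd s hs').deriv]
    have h1 : G' s ≤ H s := by
      simp only [hG', max_eq_left hs'.1]; exact hGH s hs'
    have h2 := h.mono h1
    have h3 : 0 < H s + ω (H s) := add_pos_of_pos_of_nonneg (hHpos s hs') (h.nonneg _)
    rw [sub_nonpos, one_div, inv_mul_le_iff₀ h3, mul_comm]
    exact mul_le_mul_of_nonneg_right (add_le_add h1 h2) hK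
  have h1 := hanti ⟨le_rfl, ht.1.trans ht.2⟩ ht ht.1
  have hH0 : H 0 = a := by simp [hH]
  simp only [hH0, mul_zero, sub_zero] at h1
  have h2 := h.strictMonoOn_psiReal.monotoneOn (a := u t) (b := H t) hpos (hHpos t ht)
    ((hle t ht).trans (hGH t ht))
  linarith

/-- The Osgood inequality for a function given on a compact interval. -/
theorem IsOsgoodModulus.psiReal_le_of_Icc (h : IsOsgoodModulus ω) {u : ℝ → ℝ} {a K B T : ℝ}
    (ha : 0 < a) (hK : 0 ≤ K) (hu : Measurable ((Icc 0 T).indicator u))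
    (hu0 : ∀ t ∈ Icc 0 T, 0 ≤ u t) (huB : ∀ t ∈ Icc 0 T, u t ≤ B)
    (hle : ∀ t ∈ Icc 0 T, u t ≤ a + ∫ s in (0 : ℝ)..t, K * (u s + ω (u s)))
    {t : ℝ} (ht : t ∈ Icc 0 T) (hpos : 0 < u t) :
    psiReal ω (u t) ≤ psiReal ω a + K * t := by
  have hB : 0 ≤ B := (hu0 t ht).trans (huB t ht)
  have key := h.psiReal_le (u := (Icc 0 T).indicator u) (B := B) (T := T) (t := t) ha hK hu
    (fun s => indicator_nonneg hu0 s) (fun s => ?_) (fun s hs => ?_) ht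
    (by rwa [indicator_of_mem ht])
  · rwa [indicator_of_mem ht] at key
  · by_cases hs : s ∈ Icc 0 T
    · rw [indicator_of_mem hs]; exact huB s hs
    · rwa [indicator_of_notMem hs]
  · rw [indicator_of_mem hs]
    refine (hle s hs).trans_eq ?_
    congr 1
    refine intervalIntegral.integral_congr fun r hr => ?_
    rw [uIcc_of_le hs.1] at hr
    have hr' : r ∈ Icc 0 T := ⟨hr.1, hr.2.trans hs.2⟩
    simp only [indicator_of_mem hr']

/-- Under the Osgood condition, a small perturbation of the zero initial value stays small. -/
theorem IsOsgoodModulus.exists_forall_le (h : IsOsgoodModulus ω) {K T : ℝ} (hK : 0 ≤ K)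
    {θ : ℝ} (hθ : 0 < θ) : ∃ a > 0, ∀ (u : ℝ → ℝ) (B : ℝ), Measurable ((Icc 0 T).indicator u) →
      (∀ t ∈ Icc 0 T, 0 ≤ u t) → (∀ t ∈ Icc 0 T, u t ≤ B) →
      (∀ t ∈ Icc 0 T, u t ≤ a + ∫ s in (0 : ℝ)..t, K * (u s + ω (u s))) →
      ∀ t ∈ Icc 0 T, u t ≤ θ := by
  obtain ⟨a, ha, ha0⟩ := ((h.osgood.eventually
    (eventually_lt_atBot (psiReal ω θ - K * T))).and self_mem_nhdsWithin).exists
  refine ⟨a, ha0, fun u B hu hu0 huB hle t ht => ?_⟩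
  by_contra! hcon
  have h1 := h.psiReal_le_of_Icc ha0 hK hu hu0 huB hle ht (hθ.trans hcon)
  have h2 := h.strictMonoOn_psiReal hθ (hθ.trans hcon) hcon
  have h3 : K * t ≤ K * T := mul_le_mul_of_nonneg_left ht.2 hK
  linarith

/-- Zero initial error is below every positive one, so u ≤ θ for every θ > 0. -/
theorem IsOsgoodModulus.eq_zero (h : IsOsgoodModulus ω) {u : ℝ → ℝ} {K B T : ℝ}
    (hK : 0 ≤ K) (hu : Measurable ((Icc 0 T).indicator u))
    (hu0 : ∀ t ∈ Icc 0 T, 0 ≤ u t) (huB : ∀ t ∈ Icc 0 T, u t ≤ B)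
    (hle : ∀ t ∈ Icc 0 T, u t ≤ ∫ s in (0 : ℝ)..t, K * (u s + ω (u s)))
    {t : ℝ} (ht : t ∈ Icc 0 T) : u t = 0 := by
  refine le_antisymm (le_of_forall_pos_le_add fun θ hθ => ?_) (hu0 t ht)
  obtain ⟨a, ha, H⟩ := h.exists_forall_le (T := T) hK hθ
  rw [zero_add]
  exact H u B hu hu0 huB (fun s hs => by linarith [hle s hs]) t ht

theorem IsOsgoodModulus.le_psiInv (h : IsOsgoodModulus ω) {a b u : ℝ} (ha : 0 < a) (hu : 0 < u)
    (hle : psiReal ω u ≤ psiReal ω a + b) : u ≤ psiInv ω (psi ω a + (b : EReal)) := by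
  have e : psi ω a + (b : EReal) = ((psiReal ω a + b : ℝ) : EReal) := by
    rw [psi, if_pos ha, EReal.coe_add]
  rw [e]
  refine le_csSup ?_ ⟨hu.le, by rw [psi, if_pos hu]; exact_mod_cast hle⟩
  obtain ⟨N, hN, hN0⟩ := ((h.tendsto_psiReal_atTop.eventually
    (eventually_gt_atTop (psiReal ω a + b))).and (eventually_gt_atTop 0)).exists
  refine ⟨N, ?_⟩
  rintro w ⟨hw0, hw⟩
  by_contra! hcon
  have hw0 : 0 < w := hN0.trans hcon
  rw [psi, if_pos hw0, EReal.coe_le_coe_iff] at hw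
  have := h.strictMonoOn_psiReal hN0 hw0 hcon
  linarith

theorem psiInv_nonneg (ω : ℝ → ℝ) (y : EReal) : 0 ≤ psiInv ω y :=
  Real.sSup_nonneg fun _ h => h.1

end osgood

/-! ### Dependence of the velocity on the densities -/

theorem abs_mul_sub_mul_le {a₀ a₁ b₀ b₁ c : ℝ} (ha₀ : 0 < a₀) (ha₁ : 0 < a₁)
    (h₀ : |b₀ / a₀ - 1| ≤ c) (h₁ : |b₁ / a₁ - 1| ≤ c) :
    |a₀ * a₁ - b₀ * b₁| ≤ ((1 + c) * (1 + c) - 1) * (a₀ * a₁) := by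
  have e : b₀ * b₁ - a₀ * a₁ = (b₀ / a₀ * (b₁ / a₁) - 1) * (a₀ * a₁) := by field_simp
  rw [abs_sub_comm, e, abs_mul, abs_of_pos (mul_pos ha₀ ha₁)]
  exact mul_le_mul_of_nonneg_right (abs_mul_sub_one_le h₀ h₁) (mul_pos ha₀ ha₁).le

theorem abs_sub_one_le_of_abs_log_le {x r : ℝ} (hx : 0 < x) (h : |Real.log x| ≤ r) :
    |x - 1| ≤ Real.exp r - 1 := by
  rw [abs_le] at h
  have h1 : x ≤ Real.exp r := (Real.log_le_iff_le_exp hx).1 h.2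
  have h2 : Real.exp (-r) ≤ x := (Real.le_log_iff_exp_le hx).1 h.1
  have h3 := Real.add_one_le_exp r
  have h4 := Real.add_one_le_exp (-r)
  have h5 : Real.exp r * Real.exp (-r) = 1 := by rw [← Real.exp_add]; simp
  rw [abs_le]
  constructor
  -- The lower side needs 1 - e^{-r} ≤ e^r - 1, that is e^r + e^{-r} ≥ 2.
  · nlinarith [sq_nonneg (Real.exp r - 1), Real.exp_pos r, Real.exp_pos (-r)]
  · linarith

/-- Stability of the velocity under perturbation of the densities. -/
theorem norm_velocity_sub_velocity_le {Ω : Set (Pt d)} {lo hi lo' hi' r : ℝ}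
    {p₀ p₁ q₀ q₁ : Pt d → ℝ} (hΩ : IsCompact Ω) (hlo : 0 < lo) (hlo' : 0 < lo')
    (hp₀ : IsWeightOn Ω lo hi p₀) (hp₁ : IsWeightOn Ω lo hi p₁)
    (hq₀ : IsWeightOn Ω lo' hi' q₀) (hq₁ : IsWeightOn Ω lo' hi' q₁)
    (hr : ∀ x ∈ Ω, logRatio p₀ p₁ q₀ q₁ x ≤ r) {t : ℝ} (ht : t ∈ Icc (0 : ℝ) 1) {z : Pt d}
    (hz : z ∈ interior Ω) :
    ‖velocity Ω q₀ q₁ t z - velocity Ω p₀ p₁ t z‖ ≤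
      2 * Metric.diam Ω * (Real.exp (2 * r) - 1) := by
  have iF := integrable_weight hΩ hlo' hq₀ hq₁ t z
  have iG := integrable_weight hΩ hlo hp₀ hp₁ t z
  have posG := integral_weight_pos hΩ hlo hp₀ hp₁ ht hz
  -- The weight of q plays the role of F, so the mass of the weight of p normalises, matching the
  -- ratios q/p in `logRatio`.
  have key := norm_mean_sub_mean_le Metric.diam_nonneg iF iG (weight_nonneg hlo' hq₀ hq₁ t z)
    (fun δ h => norm_le_of_weight_ne_zero hΩ h) (fun δ h => norm_le_of_weight_ne_zero hΩ h)
    (integral_weight_pos hΩ hlo' hq₀ hq₁ ht hz) posG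
  rw [velocity_eq_mean hΩ.measurableSet, velocity_eq_mean hΩ.measurableSet, norm_sub_rev]
  refine key.trans ?_
  rw [mul_div_assoc]
  refine mul_le_mul_of_nonneg_left ?_ (mul_nonneg zero_le_two Metric.diam_nonneg)
  rw [div_le_iff₀ posG, ← integral_const_mul]
  refine integral_mono (iG.sub iF).abs (iG.const_mul _) fun δ => ?_
  simp only
  by_cases h : δ ∈ admissible Ω t z
  · rw [weight_of_mem h, weight_of_mem h]
    have a0 := hlo.trans_le (hp₀.lower _ h.1)
    have a1 := hlo.trans_le (hp₁.lower _ h.2)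
    have b0 := hlo'.trans_le (hq₀.lower _ h.1)
    have b1 := hlo'.trans_le (hq₁.lower _ h.2)
    have e : Real.exp (2 * r) - 1 =
        (1 + (Real.exp r - 1)) * (1 + (Real.exp r - 1)) - 1 := by
      rw [two_mul, Real.exp_add]; ring
    rw [e]
    exact abs_mul_sub_mul_le a0 a1
      (abs_sub_one_le_of_abs_log_le (div_pos b0 a0) ((le_max_left _ _).trans (hr _ h.1)))
      (abs_sub_one_le_of_abs_log_le (div_pos b1 a1) ((le_max_right _ _).trans (hr _ h.2)))
  · simp [weight_of_notMem h]

/-! ### Dependence of the velocity on the position -/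

theorem smul_mem_admissible {Ω : Set (Pt d)} (hc : Convex ℝ Ω) {z z' : Pt d} {ρ l t : ℝ}
    (hz : Metric.closedBall z ρ ⊆ Ω) (hzΩ : z ∈ Ω) (hl0 : 0 ≤ l) (hl1 : l ≤ 1)
    (hzz : ‖z' - z‖ ≤ l * ρ)
    {δ : Pt d} (hδ : δ ∈ admissible Ω t z) : (1 - l) • δ ∈ admissible Ω t z' := by
  -- The homothety with centre w and ratio 1-l maps Ω into itself and z to z'; it scales
  -- displacements by 1-l. The centre is found by extending the step from z to z' to length at most
  -- ρ.
  have main : ∃ w ∈ Ω, z' = (1 - l) • z + l • w := by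
    rcases hl0.eq_or_lt with h | h
    · rw [← h, zero_mul] at hzz
      refine ⟨z, hzΩ, ?_⟩
      rw [← h, sub_eq_zero.1 (norm_le_zero_iff.1 hzz)]
      simp
    · refine ⟨z + l⁻¹ • (z' - z), hz ?_, ?_⟩
      · rw [mem_closedBall_iff_norm, add_sub_cancel_left, norm_smul,
          Real.norm_of_nonneg (inv_nonneg.2 hl0), inv_mul_le_iff₀ h]
        exact hzz
      · rw [smul_add, smul_smul, mul_inv_cancel₀ h.ne']; module
  obtain ⟨w, hw, rfl⟩ := main
  constructor
  · convert hc hδ.1 hw (sub_nonneg.2 hl1) hl0 (sub_add_cancel 1 l) using 1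
    module
  · convert hc hδ.2 hw (sub_nonneg.2 hl1) hl0 (sub_add_cancel 1 l) using 1
    module

open scoped Pointwise in
theorem volume_real_smul (S : Set (Pt d)) {l : ℝ} (hl : 0 ≤ l) :
    volume.real (l • S) = l ^ d * volume.real S := by
  rw [measureReal_def, Measure.addHaar_smul, ENNReal.toReal_mul, finrank_euclideanSpace,
    Fintype.card_fin, abs_of_nonneg (pow_nonneg hl d), ENNReal.toReal_ofReal (pow_nonneg hl d),
    measureReal_def]

-- The scaled set (1-l)S_t(z) lies in both sets: in S_t(z') by the homothety, and in S_t(z) by the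
-- same argument with z' = z.
open scoped Pointwise in
theorem pow_mul_volume_admissible_le {Ω : Set (Pt d)} (hΩ : IsCompact Ω) (hc : Convex ℝ Ω)
    {z z' : Pt d} {ρ l t : ℝ} (hz : Metric.closedBall z ρ ⊆ Ω) (hzΩ : z ∈ Ω) (hρ : 0 ≤ ρ)
    (hl0 : 0 ≤ l) (hl1 : l ≤ 1) (hzz : ‖z' - z‖ ≤ l * ρ) :
    (1 - l) ^ d * volume.real (admissible Ω t z) ≤
      volume.real (admissible Ω t z ∩ admissible Ω t z') := by
  rw [← volume_real_smul _ (sub_nonneg.2 hl1)]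
  refine measureReal_mono ?_ ((measure_mono inter_subset_left).trans_lt
    ((isBounded_admissible hΩ.isBounded t z).measure_lt_top (μ := volume))).ne
  rintro _ ⟨δ, hδ, rfl⟩
  exact ⟨smul_mem_admissible hc hz hzΩ hl0 hl1 (by simpa using mul_nonneg hl0 hρ) hδ,
    smul_mem_admissible hc hz hzΩ hl0 hl1 hzz hδ⟩

/-- Bernoulli's inequality (1-l)^d ≥ 1 - dl bounds the relative volume lost. -/
theorem volume_admissible_diff_le {Ω : Set (Pt d)} (hΩ : IsCompact Ω) (hc : Convex ℝ Ω)
    {z z' : Pt d} {ρ l t : ℝ} (hz : Metric.closedBall z ρ ⊆ Ω) (hzΩ : z ∈ Ω) (hρ : 0 ≤ ρ)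
    (hl0 : 0 ≤ l) (hl1 : l ≤ 1) (hzz : ‖z' - z‖ ≤ l * ρ) :
    volume.real (admissible Ω t z \ admissible Ω t z') ≤
      d * l * volume.real (admissible Ω t z) := by
  have h1 := pow_mul_volume_admissible_le (t := t) hΩ hc hz hzΩ hρ hl0 hl1 hzz
  have hfin := (isBounded_admissible hΩ.isBounded t z).measure_lt_top (μ := volume)
  have h2 := measureReal_inter_add_sdiff (μ := volume) (s := admissible Ω t z)
    (measurableSet_admissible hΩ.measurableSet t z') hfin.ne
  have h3 : 1 + (d : ℝ) * (-l) ≤ (1 + -l) ^ d := one_add_mul_le_pow (by linarith) d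
  have h4 : (0 : ℝ) ≤ volume.real (admissible Ω t z) := measureReal_nonneg
  rw [← sub_eq_add_neg] at h3
  have h5 := mul_le_mul_of_nonneg_right h3 h4
  nlinarith

/-- The constant in the modulus of continuity of the velocity. -/
noncomputable def velocityConst (d : ℕ) (lo hi : ℝ) : ℝ :=
  4 + hi / lo + 2 * d * (2 ^ d + 1) * (hi / lo) ^ 2

section modulus

variable {Ω : Set (Pt d)} {lo hi : ℝ} {p₀ p₁ : Pt d → ℝ}

/-- For a displacement admissible at both points, the arguments of each density differ by exactly
z'-z, so ω controls the ratios. Elsewhere one weight vanishes and the other is at most hi², on a set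
of small volume; the lower bound lo² converts volume into mass. -/
theorem integral_abs_weight_sub_le (hΩ : IsCompact Ω) (hc : Convex ℝ Ω) (hlo : 0 < lo)
    (hp₀ : IsWeightOn Ω lo hi p₀) (hp₁ : IsWeightOn Ω lo hi p₁) (t : ℝ)
    {z z' : Pt d} {ρ : ℝ} (hρ : 0 < ρ) (hz : Metric.closedBall z ρ ⊆ Ω)
    (hzz : ‖z' - z‖ < ρ / 4) :
    ∫ δ, |weight Ω p₀ p₁ t z' δ - weight Ω p₀ p₁ t z δ| ≤
      velocityConst d lo hi * (ratioModulus Ω p₀ p₁ ‖z' - z‖ + ‖z' - z‖ / ρ) *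
        ∫ δ, weight Ω p₀ p₁ t z' δ := by
  have hzΩ : z ∈ Ω := hz (Metric.mem_closedBall_self hρ.le)
  have hz'b : Metric.closedBall z' (ρ / 2) ⊆ Ω := by
    refine (Metric.closedBall_subset_closedBall' ?_).trans hz
    rw [dist_eq_norm]; linarith
  have hz'Ω : z' ∈ Ω := hz'b (Metric.mem_closedBall_self (by positivity))
  have hzb : Metric.closedBall z (ρ / 2) ⊆ Ω :=
    (Metric.closedBall_subset_closedBall (by linarith)).trans hz
  set S := admissible Ω t z with hS
  set S' := admissible Ω t z' with hS'
  have mS : MeasurableSet S := measurableSet_admissible hΩ.measurableSet t z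
  have mS' : MeasurableSet S' := measurableSet_admissible hΩ.measurableSet t z'
  have fS := (isBounded_admissible hΩ.isBounded t z).measure_lt_top (μ := volume)
  have fS' := (isBounded_admissible hΩ.isBounded t z').measure_lt_top (μ := volume)
  have iF := integrable_weight hΩ hlo hp₀ hp₁ t z
  have iG := integrable_weight hΩ hlo hp₀ hp₁ t z'
  set ω := ratioModulus Ω p₀ p₁ ‖z' - z‖ with hω
  have hω0 : 0 ≤ ω := ratioModulus_nonneg _ _ _ _
  have hb := hp₀.isBoundedPair hp₁
  have hωM : ω ≤ hi / lo := hb.ratioModulus_le_div hlo ⟨z, hzΩ⟩ _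
  -- Both z and z' have depth ρ/2, and lρ/2 = ‖z'-z‖; so the volume estimate applies in both
  -- directions, with l ≤ 1/2.
  set l := 2 * ‖z' - z‖ / ρ with hl
  have hl0 : 0 ≤ l := by positivity
  have hl2 : l ≤ 1 / 2 := by rw [hl, div_le_iff₀ hρ]; linarith
  have hlρ : ‖z' - z‖ = l * (ρ / 2) := by rw [hl]; field_simp
  have v1 := volume_admissible_diff_le (t := t) hΩ hc hzb hzΩ (by positivity) hl0
    (by linarith) hlρ.le
  have v2 := volume_admissible_diff_le (t := t) hΩ hc hz'b hz'Ω (by positivity) hl0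
    (by linarith) ((norm_sub_rev _ _).trans hlρ).le
  -- With l ≤ 1/2 the homothety loses at most a factor 2^d, so both differences are measured against
  -- S' alone, whose mass is the normaliser.
  have v3 : volume.real S ≤ 2 ^ d * volume.real S' := by
    have h1 := pow_mul_volume_admissible_le (t := t) hΩ hc hzb hzΩ (by positivity) hl0
      (by linarith) hlρ.le
    have h2 : volume.real (S ∩ S') ≤ volume.real S' := measureReal_mono inter_subset_right fS'.ne
    have h3 : (1 / 2 : ℝ) ^ d ≤ (1 - l) ^ d := pow_le_pow_left₀ (by norm_num) (by linarith) d
    have h4 : (0 : ℝ) ≤ volume.real S := measureReal_nonneg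
    have h5 := (mul_le_mul_of_nonneg_right h3 h4).trans (h1.trans h2)
    rwa [one_div, inv_pow, inv_mul_le_iff₀ (by positivity)] at h5
  have iD : ∀ A B : Set (Pt d), MeasurableSet A → MeasurableSet B → volume A < ⊤ →
      Integrable ((A \ B).indicator fun _ => hi ^ 2) := fun A B hA hB hf =>
    (integrable_indicator_iff (hA.diff hB)).2
      (integrableOn_const ((measure_mono sdiff_subset).trans_lt hf).ne)
  have pt : ∀ δ, |weight Ω p₀ p₁ t z' δ - weight Ω p₀ p₁ t z δ| ≤
      ((1 + ω) * (1 + ω) - 1) * weight Ω p₀ p₁ t z' δ +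
        ((S \ S').indicator (fun _ => hi ^ 2) δ + (S' \ S).indicator (fun _ => hi ^ 2) δ) := by
    intro δ
    have w0 := weight_nonneg hlo hp₀ hp₁ t z δ
    have w1 := weight_nonneg hlo hp₀ hp₁ t z' δ
    have c0 : 0 ≤ (1 + ω) * (1 + ω) - 1 := by nlinarith
    by_cases h : δ ∈ S <;> by_cases h' : δ ∈ S'
    · rw [indicator_of_notMem (fun hh => hh.2 h'), indicator_of_notMem (fun hh => hh.2 h),
        weight_of_mem h, weight_of_mem h', add_zero, add_zero]
      have e0 : (z - t • δ) - (z' - t • δ) = z - z' := by abel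
      have e1 : (z + (1 - t) • δ) - (z' + (1 - t) • δ) = z - z' := by abel
      refine abs_mul_sub_mul_le (hlo.trans_le (hp₀.lower _ h'.1))
        (hlo.trans_le (hp₁.lower _ h'.2))
        (hb.le_ratioModulus hlo h.1 h'.1 ?_).1 (hb.le_ratioModulus hlo h.2 h'.2 ?_).2
      · rw [e0, norm_sub_rev]
      · rw [e1, norm_sub_rev]
    · rw [indicator_of_mem (show δ ∈ S \ S' from ⟨h, h'⟩),
        indicator_of_notMem (fun hh => h' hh.1), weight_of_notMem h', zero_sub, abs_neg,
        abs_of_nonneg w0]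
      have := weight_le_of_mem hlo hp₀ hp₁ h
      linarith
    · rw [indicator_of_notMem (fun hh => h hh.1), indicator_of_mem (show δ ∈ S' \ S from ⟨h', h⟩),
        weight_of_notMem h, sub_zero, abs_of_nonneg w1]
      have := weight_le_of_mem hlo hp₀ hp₁ h'
      nlinarith
    · rw [indicator_of_notMem (fun hh => h hh.1), indicator_of_notMem (fun hh => h' hh.1),
        weight_of_notMem h, weight_of_notMem h']
      simp
  have main := integral_mono (iG.sub iF).abs
    ((iG.const_mul ((1 + ω) * (1 + ω) - 1)).add ((iD S S' mS mS' fS).add (iD S' S mS' mS fS'))) pt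
  simp only [Pi.sub_apply] at main
  refine main.trans ?_
  rw [integral_add' (iG.const_mul _) ((iD S S' mS mS' fS).add (iD S' S mS' mS fS')),
    integral_add' (iD S S' mS mS' fS) (iD S' S mS' mS fS'), integral_const_mul,
    integral_indicator (mS.diff mS'), integral_indicator (mS'.diff mS), setIntegral_const,
    setIntegral_const, smul_eq_mul, smul_eq_mul]
  have lower := mul_volume_le_integral_weight hΩ hlo hp₀ hp₁ t z'
  rw [← hS'] at lower
  set N := ∫ δ, weight Ω p₀ p₁ t z' δ
  have hV' : (0 : ℝ) ≤ volume.real S' := measureReal_nonneg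
  have hN : 0 ≤ N := (mul_nonneg (sq_nonneg lo) hV').trans lower
  have hhi : hi ^ 2 * volume.real S' ≤ (hi / lo) ^ 2 * N := by
    have : hi ^ 2 * volume.real S' = (hi / lo) ^ 2 * (lo ^ 2 * volume.real S') := by
      field_simp
    rw [this]
    exact mul_le_mul_of_nonneg_left lower (sq_nonneg _)
  have t1 : ((1 + ω) * (1 + ω) - 1) * N ≤ (2 + hi / lo) * ω * N := by
    refine mul_le_mul_of_nonneg_right ?_ hN
    nlinarith
  have t2 : volume.real (S \ S') * hi ^ 2 + volume.real (S' \ S) * hi ^ 2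
      ≤ d * l * (2 ^ d + 1) * ((hi / lo) ^ 2 * N) := by
    have hdl : 0 ≤ (d : ℝ) * l := by positivity
    have s1 : volume.real (S \ S') + volume.real (S' \ S)
        ≤ d * l * (2 ^ d + 1) * volume.real S' := by
      have := mul_le_mul_of_nonneg_left v3 hdl
      linarith
    calc _ = (volume.real (S \ S') + volume.real (S' \ S)) * hi ^ 2 := by ring
      _ ≤ d * l * (2 ^ d + 1) * volume.real S' * hi ^ 2 :=
          mul_le_mul_of_nonneg_right s1 (sq_nonneg _)
      _ = d * l * (2 ^ d + 1) * (hi ^ 2 * volume.real S') := by ring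
      _ ≤ _ := mul_le_mul_of_nonneg_left hhi (by positivity)
  have hM0 : 0 ≤ hi / lo := hω0.trans hωM
  set X := ‖z' - z‖ / ρ with hX
  have hX0 : 0 ≤ X := by positivity
  have hlX : l = 2 * X := by rw [hl, hX]; ring
  rw [hlX] at t2
  have r1 : 0 ≤ (2 + 2 * d * (2 ^ d + 1) * (hi / lo) ^ 2) * ω * N := by positivity
  have r2 : 0 ≤ (4 + hi / lo) * X * N := by positivity
  -- One constant multiplies both ω and ‖z'-z‖/ρ; the last two summands are what it gives away.
  have goal : velocityConst d lo hi * (ω + X) * N =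
      (2 + hi / lo) * ω * N + d * (2 * X) * (2 ^ d + 1) * ((hi / lo) ^ 2 * N) +
      (2 + 2 * d * (2 ^ d + 1) * (hi / lo) ^ 2) * ω * N + (4 + hi / lo) * X * N := by
    rw [velocityConst]; ring
  rw [goal]
  linarith

/-- The modulus of continuity of the velocity at a point at distance `ρ` from the boundary. -/
theorem norm_velocity_sub_le (hΩ : IsCompact Ω) (hc : Convex ℝ Ω) (hlo : 0 < lo)
    (hp₀ : IsWeightOn Ω lo hi p₀) (hp₁ : IsWeightOn Ω lo hi p₁) {t : ℝ} (ht : t ∈ Icc (0 : ℝ) 1)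
    {z z' : Pt d} {ρ : ℝ} (hρ : 0 < ρ) (hz : Metric.closedBall z ρ ⊆ Ω) :
    ‖velocity Ω p₀ p₁ t z' - velocity Ω p₀ p₁ t z‖ ≤
      2 * Metric.diam Ω * (velocityConst d lo hi *
        (ratioModulus Ω p₀ p₁ ‖z' - z‖ + ‖z' - z‖ / ρ)) := by
  have hzΩ : z ∈ Ω := hz (Metric.mem_closedBall_self hρ.le)
  have hD : 0 ≤ Metric.diam Ω := Metric.diam_nonneg
  have hhi : 0 ≤ hi / lo :=
    div_nonneg (hlo.le.trans ((hp₀.lower z hzΩ).trans (hp₀.upper z hzΩ))) hlo.le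
  have hω0 := ratioModulus_nonneg Ω p₀ p₁ ‖z' - z‖
  rcases lt_or_ge ‖z' - z‖ (ρ / 4) with h | h
  · have hzi : z ∈ interior Ω :=
      interior_mono hz (Metric.ball_subset_interior_closedBall (Metric.mem_ball_self hρ))
    have hzi' : z' ∈ interior Ω := by
      refine interior_mono hz (Metric.ball_subset_interior_closedBall ?_)
      rw [mem_ball_iff_norm]; linarith
    have posG := integral_weight_pos hΩ hlo hp₀ hp₁ ht hzi'
    have key := norm_mean_sub_mean_le hD (integrable_weight hΩ hlo hp₀ hp₁ t z)
      (integrable_weight hΩ hlo hp₀ hp₁ t z') (weight_nonneg hlo hp₀ hp₁ t z)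
      (fun δ h => norm_le_of_weight_ne_zero hΩ h) (fun δ h => norm_le_of_weight_ne_zero hΩ h)
      (integral_weight_pos hΩ hlo hp₀ hp₁ ht hzi) posG
    rw [velocity_eq_mean hΩ.measurableSet, velocity_eq_mean hΩ.measurableSet]
    refine key.trans ?_
    rw [mul_div_assoc]
    refine mul_le_mul_of_nonneg_left ?_ (by positivity)
    rw [div_le_iff₀ posG]
    exact integral_abs_weight_sub_le hΩ hc hlo hp₀ hp₁ t hρ hz h
  -- For distant points the trivial bound 2 diam(Ω) suffices: ‖z'-z‖/ρ ≥ 1/4, and the summand 4 of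
  -- `velocityConst` makes the other factor at least 1. Here z' may lie outside Ω.
  · have h1 := norm_velocity_le hΩ hlo hp₀ hp₁ t z
    have h2 := norm_velocity_le hΩ hlo hp₀ hp₁ t z'
    have h3 : 1 / 4 ≤ ‖z' - z‖ / ρ := by rw [le_div_iff₀ hρ]; linarith
    have h4 : (4 : ℝ) ≤ velocityConst d lo hi := by
      have : 0 ≤ 2 * (d : ℝ) * (2 ^ d + 1) * (hi / lo) ^ 2 := by positivity
      rw [velocityConst]; linarith
    have h5 : 1 ≤ velocityConst d lo hi *
        (ratioModulus Ω p₀ p₁ ‖z' - z‖ + ‖z' - z‖ / ρ) := by nlinarith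
    calc _ ≤ Metric.diam Ω + Metric.diam Ω := (norm_sub_le _ _).trans (add_le_add h2 h1)
      _ = 2 * Metric.diam Ω * 1 := by ring
      _ ≤ _ := mul_le_mul_of_nonneg_left h5 (by positivity)

end modulus

/-! ### Convexity and the distance of a path from the boundary -/

theorem closedBall_combo_subset {Ω : Set (Pt d)} (hc : Convex ℝ Ω) {x w : Pt d} {ε t : ℝ}
    (hx : Metric.closedBall x ε ⊆ Ω) (hw : w ∈ Ω) (ht : t ∈ Icc (0 : ℝ) 1) :
    Metric.closedBall ((1 - t) • x + t • w) ((1 - t) * ε) ⊆ Ω := by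
  intro y hy
  rw [mem_closedBall_iff_norm] at hy
  rcases ht.2.eq_or_lt with h | h
  · rw [h, sub_self, zero_mul, norm_le_zero_iff, sub_eq_zero] at hy
    rw [hy]; simpa using hw
  · have h1 : 0 < 1 - t := sub_pos.2 h
    -- The homothety with centre w and ratio 1-t carries the ball about x onto the ball in question
    -- and keeps Ω inside Ω.
    have e : y = (1 - t) • (x + (1 - t)⁻¹ • (y - ((1 - t) • x + t • w))) + t • w := by
      rw [smul_add, smul_smul, mul_inv_cancel₀ h1.ne']; module
    rw [e]
    refine hc (hx ?_) hw h1.le ht.1 (sub_add_cancel 1 t)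
    rw [mem_closedBall_iff_norm, add_sub_cancel_left, norm_smul,
      Real.norm_of_nonneg (inv_nonneg.2 h1.le), inv_mul_le_iff₀ h1]
    exact hy

/-- A path whose velocity always points to a target in `Ω` to be reached at time `1` is, at
time `t`, a convex combination of its starting point and a point of `Ω`. -/
theorem exists_eq_combo_of_integral_eq {Ω : Set (Pt d)} (hcl : IsClosed Ω) (hc : Convex ℝ Ω)
    (hne : Ω.Nonempty) {x : Pt d} {y V : ℝ → Pt d} {T : ℝ} (hT : T ≤ 1)
    (hV : IntervalIntegrable V volume 0 T)
    (hy : ∀ t ∈ Icc 0 T, y t = x + ∫ s in (0 : ℝ)..t, V s)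
    (hm : ∀ s ∈ Ioo 0 T, y s + (1 - s) • V s ∈ Ω) {t : ℝ} (ht : t ∈ Icc 0 T) :
    ∃ w ∈ Ω, y t = (1 - t) • x + t • w := by
  rcases ht.1.eq_or_lt with h0 | h0
  · obtain ⟨w, hw⟩ := hne
    refine ⟨w, hw, ?_⟩
    rw [hy t ht, ← h0]; simp
  refine ⟨t⁻¹ • (y t - (1 - t) • x), ?_, ?_⟩
  swap
  · rw [smul_smul, mul_inv_cancel₀ h0.ne']; module
  by_contra hcon
  -- A functional f < c on Ω separates the claimed point from Ω. Then φ(s) = f(y(s)) - (1-s)f(x) -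
  -- sc, the integral of g, vanishes at 0 and is positive at t; yet it cannot increase where it is
  -- positive, which is tested after the last time a with φ ≤ 0.
  obtain ⟨f, c, hf, hfc⟩ := geometric_hahn_banach_closed_point hc hcl hcon
  have hT0 : 0 ≤ T := ht.1.trans ht.2
  set g : ℝ → ℝ := fun s => f (V s) + (f x - c) with hg
  have hsub : ∀ {a b : ℝ}, a ∈ Icc 0 T → b ∈ Icc 0 T → uIcc a b ⊆ uIcc 0 T := by
    intro a b ha hb
    rw [uIcc_of_le hT0]
    exact uIcc_subset_Icc ha hb
  have h0T : (0 : ℝ) ∈ Icc 0 T := ⟨le_rfl, hT0⟩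
  have hfV : IntervalIntegrable (fun s => f (V s)) volume 0 T :=
    ⟨f.integrable_comp hV.1, f.integrable_comp hV.2⟩
  have hgi : IntervalIntegrable g volume 0 T := hfV.add intervalIntegrable_const
  have hφ : ∀ s ∈ Icc 0 T, ∫ r in (0 : ℝ)..s, g r = f (y s) - (1 - s) * f x - s * c := by
    intro s hs
    rw [intervalIntegral.integral_add (hfV.mono_set (hsub h0T hs)) intervalIntegrable_const,
      intervalIntegral.integral_const, f.intervalIntegral_comp_comm (hV.mono_set (hsub h0T hs)),
      hy s hs, map_add, smul_eq_mul]
    ring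
  set φ : ℝ → ℝ := fun s => ∫ r in (0 : ℝ)..s, g r with hφd
  have hφc : ContinuousOn φ (Icc 0 T) := by
    have := intervalIntegral.continuousOn_primitive_interval' hgi left_mem_uIcc
    rwa [uIcc_of_le hT0] at this
  have hφt : 0 < φ t := by
    rw [map_smul, map_sub, map_smul, smul_eq_mul, smul_eq_mul, lt_inv_mul_iff₀ h0] at hfc
    have := hφ t ht
    change φ t = _ at this
    linarith
  set A := Icc 0 t ∩ φ ⁻¹' Iic 0 with hA
  have hAcl : IsClosed A :=
    (hφc.mono (Icc_subset_Icc_right ht.2)).preimage_isClosed_of_isClosed isClosed_Icc isClosed_Iic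
  have hA0 : (0 : ℝ) ∈ A := ⟨⟨le_rfl, ht.1⟩, by simp [hφd]⟩
  have hAb : BddAbove A := ⟨t, fun s hs => hs.1.2⟩
  set a := sSup A
  have ha : a ∈ A := hAcl.csSup_mem ⟨0, hA0⟩ hAb
  have haT : a ∈ Icc 0 T := ⟨ha.1.1, ha.1.2.trans ht.2⟩
  have hpos : ∀ s ∈ Ioo a t, 0 < φ s := by
    intro s hs
    by_contra! hle
    exact absurd (le_csSup hAb ⟨⟨ha.1.1.trans hs.1.le, hs.2.le⟩, hle⟩) (not_le.2 hs.1)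
  have hdiff : φ t - φ a = ∫ s in a..t, g s :=
    intervalIntegral.integral_interval_sub_left (hgi.mono_set (hsub h0T ht))
      (hgi.mono_set (hsub h0T haT))
  have hneg : ∫ s in a..t, g s ≤ ∫ s in a..t, (0 : ℝ) := by
    refine intervalIntegral.integral_mono_on_of_le_Ioo ha.1.2 (hgi.mono_set (hsub haT ht))
      intervalIntegrable_const fun s hs => ?_
    have hs0 : 0 < s := ha.1.1.trans_lt hs.1
    have hsT : s < T := hs.2.trans_le ht.2
    have h1 : 0 < 1 - s := by linarith
    have h2 := hf _ (hm s ⟨hs0, hsT⟩)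
    have h3 := hpos s hs
    have hφs := hφ s ⟨hs0.le, hsT.le⟩
    change φ s = _ at hφs
    rw [hφs] at h3
    rw [map_add, map_smul, smul_eq_mul] at h2
    -- Inserting f(y(s)) + (1-s)f(V(s)) < c gives (1-s)g(s) < -φ(s) < 0.
    have h4 : (1 - s) * g s < 0 := by simp only [hg]; nlinarith
    exact (neg_of_mul_neg_right h4 h1.le).le
  rw [intervalIntegral.integral_zero] at hneg
  have : φ a ≤ 0 := ha.2
  linarith

section solutions

variable {Ω : Set (Pt d)} {lo hi : ℝ} {p₀ p₁ : Pt d → ℝ}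

theorem IsSolution.continuousOn {v : ℝ → Pt d → Pt d} {x : Pt d} {T : ℝ} {y : ℝ → Pt d}
    (h : IsSolution Ω v x T y) (hT : 0 ≤ T) : ContinuousOn y (Icc 0 T) := by
  have := intervalIntegral.continuousOn_primitive_interval' h.integrable left_mem_uIcc
  rw [uIcc_of_le hT] at this
  exact (continuousOn_const.add this).congr h.eq_integral

theorem IsSolution.mono {v : ℝ → Pt d → Pt d} {x : Pt d} {T S : ℝ} {y : ℝ → Pt d}
    (h : IsSolution Ω v x T y) (hS : 0 ≤ S) (hST : S ≤ T) : IsSolution Ω v x S y where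
  mem_interior t ht := h.mem_interior t ⟨ht.1, ht.2.trans_le hST⟩
  integrable := h.integrable.mono_set (by
    rw [uIcc_of_le hS, uIcc_of_le (hS.trans hST)]; exact Icc_subset_Icc_right hST)
  eq_integral t ht := h.eq_integral t ⟨ht.1, ht.2.trans hST⟩

/-- A solution approaches the boundary at most linearly. -/
theorem IsSolution.closedBall_subset (hΩ : IsCompact Ω) (hc : Convex ℝ Ω) (hlo : 0 < lo)
    (hp₀ : IsWeightOn Ω lo hi p₀) (hp₁ : IsWeightOn Ω lo hi p₁) {x : Pt d} {ε T : ℝ}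
    {y : ℝ → Pt d} (hne : Ω.Nonempty) (hx : Metric.closedBall x ε ⊆ Ω) (hT : T ≤ 1)
    (h : IsSolution Ω (velocity Ω p₀ p₁) x T y) {t : ℝ} (ht : t ∈ Icc 0 T) :
    Metric.closedBall (y t) ((1 - t) * ε) ⊆ Ω := by
  obtain ⟨w, hw, e⟩ := exists_eq_combo_of_integral_eq hΩ.isClosed hc hne hT h.integrable
    h.eq_integral (fun s hs => (velocity_mem_admissible hΩ hc hlo hp₀ hp₁
      ⟨hs.1.le, hs.2.le.trans hT⟩ (h.mem_interior s ⟨hs.1.le, hs.2⟩)).2) ht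
  rw [e]
  exact closedBall_combo_subset hc hx hw ⟨ht.1, ht.2.trans hT⟩

/-- A solution which ends well inside `Ω` stays well inside, by time reversal. -/
theorem IsSolution.closedBall_subset_of_end (hΩ : IsCompact Ω) (hc : Convex ℝ Ω) (hlo : 0 < lo)
    (hp₀ : IsWeightOn Ω lo hi p₀) (hp₁ : IsWeightOn Ω lo hi p₁) {x : Pt d} {γ : ℝ}
    {y : ℝ → Pt d} (hne : Ω.Nonempty) (h : IsSolution Ω (velocity Ω p₀ p₁) x 1 y)
    (hy : Metric.closedBall (y 1) γ ⊆ Ω) {t : ℝ} (ht : t ∈ Icc (0 : ℝ) 1) :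
    Metric.closedBall (y t) (t * γ) ⊆ Ω := by
  have hi1 : IntervalIntegrable (fun s => -velocity Ω p₀ p₁ (1 - s) (y (1 - s))) volume 0 1 := by
    have := (h.integrable.comp_sub_left 1).symm
    rw [sub_zero, sub_self] at this
    exact this.neg
  have hsub : ∀ s ∈ Icc (0 : ℝ) 1, uIcc 0 s ⊆ uIcc (0 : ℝ) 1 := by
    intro s hs
    rw [uIcc_of_le hs.1, uIcc_of_le zero_le_one]; exact Icc_subset_Icc_right hs.2
  have hint : ∀ s ∈ Icc (0 : ℝ) 1, y (1 - s) =
      y 1 + ∫ r in (0 : ℝ)..s, -velocity Ω p₀ p₁ (1 - r) (y (1 - r)) := by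
    intro s hs
    have hs' : 1 - s ∈ Icc (0 : ℝ) 1 := ⟨by linarith [hs.2], by linarith [hs.1]⟩
    rw [intervalIntegral.integral_neg,
      intervalIntegral.integral_comp_sub_left (fun s => velocity Ω p₀ p₁ s (y s)) 1, sub_zero,
      h.eq_integral 1 ⟨zero_le_one, le_rfl⟩, h.eq_integral _ hs',
      ← intervalIntegral.integral_interval_sub_left h.integrable
        (h.integrable.mono_set (hsub _ hs'))]
    abel
  have hmem : ∀ s ∈ Ioo (0 : ℝ) 1,
      y (1 - s) + (1 - s) • -velocity Ω p₀ p₁ (1 - s) (y (1 - s)) ∈ Ω := by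
    intro s hs
    -- The other half of admissibility, z - tδ ∈ Ω, says that the reversed velocity points to a
    -- target in Ω reached at reversed time 1.
    have := (velocity_mem_admissible hΩ hc hlo hp₀ hp₁ (t := 1 - s)
      ⟨by linarith [hs.2], by linarith [hs.1]⟩
      (h.mem_interior (1 - s) ⟨by linarith [hs.2], by linarith [hs.1]⟩)).1
    rwa [smul_neg, ← sub_eq_add_neg]
  have ht' : 1 - t ∈ Icc (0 : ℝ) 1 := ⟨by linarith [ht.2], by linarith [ht.1]⟩
  obtain ⟨w, hw, e⟩ := exists_eq_combo_of_integral_eq (y := fun s => y (1 - s))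
    hΩ.isClosed hc hne le_rfl hi1 hint hmem ht'
  have := closedBall_combo_subset (t := 1 - t) hc hy hw ht'
  rw [← e] at this
  simpa using this

/-- The ball misses the frontier and is connected, so it cannot leave the interior. -/
theorem closedBall_subset_of_le_infDist (hcl : IsClosed Ω) {z : Pt d} (hz : z ∈ Ω)
    {γ : ℝ} (hγ : 0 < γ) (h : 2 * γ ≤ Metric.infDist z (frontier Ω)) :
    Metric.closedBall z γ ⊆ Ω := by
  have hfr : ∀ b ∈ Metric.closedBall z γ, b ∉ frontier Ω := by
    intro b hb hbf
    have h1 := Metric.infDist_le_dist_of_mem (x := z) hbf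
    rw [Metric.mem_closedBall, dist_comm] at hb
    linarith
  have hint : ∀ b ∈ Metric.closedBall z γ, b ∈ Ω → b ∈ interior Ω := by
    intro b hb hbΩ
    by_contra hcon
    exact hfr b hb (hcl.frontier_eq ▸ ⟨hbΩ, hcon⟩)
  have hzb : z ∈ Metric.closedBall z γ := Metric.mem_closedBall_self hγ.le
  intro w hw
  by_contra hcon
  obtain ⟨b, -, hb1, hb2⟩ := (convex_closedBall z γ).isPreconnected (interior Ω) Ωᶜ
    isOpen_interior hcl.isOpen_compl
    (fun b hb => (em (b ∈ Ω)).imp (hint b hb) id) ⟨z, hzb, hint z hzb hz⟩ ⟨w, hw, hcon⟩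
  exact hb2 (interior_subset hb1)

end solutions

/-! ### The distance of two paths, and uniqueness -/

/-- The integral inequality for the distance of two approximate solutions. -/
theorem IsOsgoodModulus.norm_sub_le_integral {ω : ℝ → ℝ} (h : IsOsgoodModulus ω)
    {y y' V V' : ℝ → Pt d} {a e K B T : ℝ} (he : 0 ≤ e) (hK : 0 ≤ K)
    (hm : Measurable ((Icc 0 T).indicator fun t => ‖y' t - y t‖))
    (hB : ∀ t ∈ Icc 0 T, ‖y' t - y t‖ ≤ B)
    (hy : ∀ t ∈ Icc 0 T, ‖y' t - y t - ∫ s in (0 : ℝ)..t, (V' s - V s)‖ ≤ a)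
    (hle : ∀ s ∈ Ico 0 T, ‖V' s - V s‖ ≤ e + K * (‖y' s - y s‖ + ω ‖y' s - y s‖))
    {t : ℝ} (ht : t ∈ Icc 0 T) :
    ‖y' t - y t‖ ≤ a + e * T + ∫ s in (0 : ℝ)..t, K * (‖y' s - y s‖ + ω ‖y' s - y s‖) := by
  obtain ⟨M, hM⟩ := h.bounded
  set u : ℝ → ℝ := fun t => ‖y' t - y t‖ with hu
  have hint : IntervalIntegrable (fun s => K * (u s + ω (u s))) volume 0 t := by
    have h1 : IntervalIntegrable (fun s => K * ((Icc 0 T).indicator u s +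
        ω ((Icc 0 T).indicator u s))) volume 0 t := by
      have hm' : Measurable (fun s => K * ((Icc 0 T).indicator u s +
        ω ((Icc 0 T).indicator u s))) := (hm.add (h.mono.measurable.comp hm)).const_mul K
      refine (intervalIntegrable_const (c := K * (B + M))).mono_fun
        hm'.aestronglyMeasurable (Eventually.of_forall fun s => ?_)
      have i0 : 0 ≤ (Icc 0 T).indicator u s := indicator_nonneg (fun _ _ => norm_nonneg _) s
      have iB : (Icc 0 T).indicator u s ≤ B := by
        by_cases hs : s ∈ Icc 0 T
        · rw [indicator_of_mem hs]; exact hB s hs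
        · rw [indicator_of_notMem hs]; exact (norm_nonneg _).trans (hB t ht)
      have h1 := mul_le_mul_of_nonneg_left (add_le_add iB (hM ((Icc 0 T).indicator u s))) hK
      have h0 := mul_nonneg hK (add_nonneg i0 (h.nonneg ((Icc 0 T).indicator u s)))
      simp only
      rw [Real.norm_of_nonneg h0, Real.norm_of_nonneg (h0.trans h1)]
      exact h1
    refine h1.congr fun s hs => ?_
    rw [uIoc_of_le ht.1] at hs
    have hs' : s ∈ Icc 0 T := ⟨hs.1.le, hs.2.trans ht.2⟩
    simp only [indicator_of_mem hs']
  -- The velocity estimate is assumed only before T, since a solution may reach the boundary at its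
  -- final time; one instant is negligible.
  have hne : ∀ᵐ s ∂(volume : Measure ℝ), s ≠ T := Measure.ae_ne volume T
  have h2 : ‖∫ s in (0 : ℝ)..t, (V' s - V s)‖ ≤ ∫ s in (0 : ℝ)..t, (e + K * (u s + ω (u s))) := by
    refine intervalIntegral.norm_integral_le_of_norm_le ht.1 ?_ (intervalIntegrable_const.add hint)
    filter_upwards [hne] with s hs hst
    exact hle s ⟨hst.1.le, lt_of_le_of_ne (hst.2.trans ht.2) hs⟩
  rw [intervalIntegral.integral_add intervalIntegrable_const hint,
    intervalIntegral.integral_const, smul_eq_mul, sub_zero, mul_comm] at h2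
  have h3 := hy t ht
  have h4 : ‖y' t - y t‖ ≤ ‖y' t - y t - ∫ s in (0 : ℝ)..t, (V' s - V s)‖ +
      ‖∫ s in (0 : ℝ)..t, (V' s - V s)‖ := by
    simpa using norm_add_le (y' t - y t - ∫ s in (0 : ℝ)..t, (V' s - V s))
      (∫ s in (0 : ℝ)..t, (V' s - V s))
  have h5 : e * t ≤ e * T := mul_le_mul_of_nonneg_left ht.2 he
  linarith

section flow

variable {Ω : Set (Pt d)} {lo hi : ℝ} {p₀ p₁ : Pt d → ℝ}

theorem velocityConst_nonneg (d : ℕ) (h : 0 ≤ hi / lo) : 0 ≤ velocityConst d lo hi := by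
  unfold velocityConst; positivity

/-- The factor by which `u + ω(u)` bounds the oscillation of the velocity at distance `ρ` from
the boundary of a set of diameter `D`. -/
noncomputable def oscConst (d : ℕ) (D lo hi ρ : ℝ) : ℝ :=
  2 * D * velocityConst d lo hi * (1 + ρ⁻¹)

theorem IsWeightOn.div_nonneg (hlo : 0 < lo) (hp₀ : IsWeightOn Ω lo hi p₀) (hne : Ω.Nonempty) :
    0 ≤ hi / lo := by
  obtain ⟨z, hz⟩ := hne
  exact _root_.div_nonneg (hlo.le.trans ((hp₀.lower z hz).trans (hp₀.upper z hz))) hlo.le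

theorem oscConst_nonneg {D ρ : ℝ} (d : ℕ) (hD : 0 ≤ D) (h : 0 ≤ hi / lo) (hρ : 0 ≤ ρ) :
    0 ≤ oscConst d D lo hi ρ := by
  have := velocityConst_nonneg (lo := lo) (hi := hi) d h
  unfold oscConst; positivity

theorem norm_velocity_sub_le_oscConst (hΩ : IsCompact Ω) (hc : Convex ℝ Ω) (hlo : 0 < lo)
    (hp₀ : IsWeightOn Ω lo hi p₀) (hp₁ : IsWeightOn Ω lo hi p₁) {t : ℝ} (ht : t ∈ Icc (0 : ℝ) 1)
    {z z' : Pt d} {ρ : ℝ} (hρ : 0 < ρ) (hz : Metric.closedBall z ρ ⊆ Ω) :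
    ‖velocity Ω p₀ p₁ t z' - velocity Ω p₀ p₁ t z‖ ≤ oscConst d (Metric.diam Ω) lo hi ρ *
      (‖z' - z‖ + ratioModulus Ω p₀ p₁ ‖z' - z‖) := by
  refine (norm_velocity_sub_le hΩ hc hlo hp₀ hp₁ ht (z' := z') hρ hz).trans ?_
  have hzΩ : z ∈ Ω := hz (Metric.mem_closedBall_self hρ.le)
  have h1 := velocityConst_nonneg d (hp₀.div_nonneg hlo ⟨z, hzΩ⟩)
  have hD : 0 ≤ Metric.diam Ω := Metric.diam_nonneg
  have hω0 := ratioModulus_nonneg Ω p₀ p₁ ‖z' - z‖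
  have h2 : ratioModulus Ω p₀ p₁ ‖z' - z‖ + ‖z' - z‖ / ρ ≤
      (1 + ρ⁻¹) * (‖z' - z‖ + ratioModulus Ω p₀ p₁ ‖z' - z‖) := by
    have h3 : 0 ≤ ρ⁻¹ * ratioModulus Ω p₀ p₁ ‖z' - z‖ := by positivity
    rw [div_eq_inv_mul]
    linarith [norm_nonneg (z' - z)]
  calc _ = 2 * Metric.diam Ω * velocityConst d lo hi *
        (ratioModulus Ω p₀ p₁ ‖z' - z‖ + ‖z' - z‖ / ρ) := by ring
    _ ≤ 2 * Metric.diam Ω * velocityConst d lo hi *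
        ((1 + ρ⁻¹) * (‖z' - z‖ + ratioModulus Ω p₀ p₁ ‖z' - z‖)) :=
        mul_le_mul_of_nonneg_left h2 (by positivity)
    _ = _ := by rw [oscConst]; ring

theorem exists_closedBall_subset {x : Pt d} (hx : x ∈ interior Ω) :
    ∃ ε > 0, Metric.closedBall x ε ⊆ Ω :=
  Metric.nhds_basis_closedBall.mem_iff.1 (mem_interior_iff_mem_nhds.1 hx)

theorem mem_interior_of_closedBall_subset {x : Pt d} {ε : ℝ} (hε : 0 < ε)
    (h : Metric.closedBall x ε ⊆ Ω) : x ∈ interior Ω :=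
  interior_mono h (Metric.ball_subset_interior_closedBall (Metric.mem_ball_self hε))

theorem measurable_indicator_norm_sub {T : ℝ} {y y' : ℝ → Pt d} (hy : ContinuousOn y (Icc 0 T))
    (hy' : ContinuousOn y' (Icc 0 T)) :
    Measurable ((Icc 0 T).indicator fun t => ‖y' t - y t‖) := by
  classical
  have := (hy'.sub hy).norm.measurable_piecewise (g := fun _ => (0 : ℝ)) continuousOn_const
    measurableSet_Icc
  rwa [← Set.piecewise_eq_indicator]

theorem exists_norm_sub_le {T : ℝ} {y y' : ℝ → Pt d} (hy : ContinuousOn y (Icc 0 T))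
    (hy' : ContinuousOn y' (Icc 0 T)) : ∃ B, ∀ t ∈ Icc 0 T, ‖y' t - y t‖ ≤ B := by
  obtain ⟨B, hB⟩ := isCompact_Icc.exists_bound_of_continuousOn (hy'.sub hy)
  exact ⟨B, hB⟩

theorem IsSolution.sub_sub_integral {v v' : ℝ → Pt d → Pt d} {x : Pt d} {T : ℝ}
    {y y' : ℝ → Pt d} (h : IsSolution Ω v x T y) (h' : IsSolution Ω v' x T y') {t : ℝ}
    (ht : t ∈ Icc 0 T) :
    y' t - y t - ∫ s in (0 : ℝ)..t, (v' s (y' s) - v s (y s)) = 0 := by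
  have i := (h.mono ht.1 ht.2).integrable
  have i' := (h'.mono ht.1 ht.2).integrable
  rw [intervalIntegral.integral_sub i' i, h.eq_integral t ht, h'.eq_integral t ht]
  abel

/-- Uniqueness of the flow. -/
theorem IsSolution.eqOn (hΩ : IsCompact Ω) (hc : Convex ℝ Ω) (hlo : 0 < lo)
    (hp₀ : IsWeightOn Ω lo hi p₀) (hp₁ : IsWeightOn Ω lo hi p₁)
    (hω : IsOsgoodModulus (ratioModulus Ω p₀ p₁)) {x : Pt d} (hx : x ∈ interior Ω) {T : ℝ}
    (hT : T ≤ 1) {y y' : ℝ → Pt d} (h : IsSolution Ω (velocity Ω p₀ p₁) x T y)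
    (h' : IsSolution Ω (velocity Ω p₀ p₁) x T y') : EqOn y' y (Icc 0 T) := by
  obtain ⟨ε, hε, hxε⟩ := exists_closedBall_subset hx
  have hne : Ω.Nonempty := ⟨x, interior_subset hx⟩
  -- On [0,t] with t < 1 the path y keeps depth (1-t)ε, so the oscillation constant is finite; no
  -- depth of y' is needed.
  have before : ∀ t ∈ Icc 0 T, t < 1 → y' t = y t := by
    intro t ht ht1
    have s := h.mono ht.1 ht.2
    have s' := h'.mono ht.1 ht.2
    have c := s.continuousOn ht.1
    have c' := s'.continuousOn ht.1
    obtain ⟨B, hB⟩ := exists_norm_sub_le c c'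
    have hρ : 0 < (1 - t) * ε := mul_pos (sub_pos.2 ht1) hε
    have hK := oscConst_nonneg (lo := lo) (hi := hi) d (Metric.diam_nonneg (s := Ω))
      (hp₀.div_nonneg hlo hne) hρ.le
    have hm := measurable_indicator_norm_sub c c'
    have key := hω.eq_zero (u := fun t => ‖y' t - y t‖) hK hm (fun _ _ => norm_nonneg _) hB
      (fun r hr => by
        have := hω.norm_sub_le_integral (y := y) (y' := y') (a := 0) le_rfl hK hm hB
          (fun r hr => (norm_le_zero_iff.2 (s.sub_sub_integral s' hr))) (fun r hr => by
            rw [zero_add]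
            refine norm_velocity_sub_le_oscConst hΩ hc hlo hp₀ hp₁
              ⟨hr.1, hr.2.le.trans ht1.le⟩ hρ ?_
            refine (Metric.closedBall_subset_closedBall ?_).trans
              (s.closedBall_subset hΩ hc hlo hp₀ hp₁ hne hxε ht1.le ⟨hr.1, hr.2.le⟩)
            exact mul_le_mul_of_nonneg_right (by linarith [hr.2]) hε.le) hr
        simpa using this) ⟨ht.1, le_rfl⟩
    exact sub_eq_zero.1 (norm_eq_zero.1 key)
  -- At time 1 the depth may vanish, but the integral equation sees only earlier times.
  intro t ht
  rw [h.eq_integral t ht, h'.eq_integral t ht]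
  congr 1
  refine intervalIntegral.integral_congr_Ioo_of_le ht.1 fun s hs => ?_
  rw [before s ⟨hs.1.le, hs.2.le.trans ht.2⟩ (hs.2.trans_le (ht.2.trans hT))]

end flow

/-! ### The Euler scheme -/

/-- The nodes of the Euler scheme with step `h`. -/
noncomputable def eulerNode (v : ℝ → Pt d → Pt d) (x : Pt d) (h : ℝ) : ℕ → Pt d
  | 0 => x
  | k + 1 => eulerNode v x h k + ∫ s in (k * h)..((k + 1) * h), v s (eulerNode v x h k)

/-- The piecewise constant Euler path with step `h`. -/
noncomputable def eulerPath (v : ℝ → Pt d → Pt d) (x : Pt d) (h t : ℝ) : Pt d :=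
  eulerNode v x h ⌊t / h⌋₊

section euler

variable {v : ℝ → Pt d → Pt d} {x : Pt d} {h D : ℝ}

theorem measurable_eulerPath (v : ℝ → Pt d → Pt d) (x : Pt d) (h : ℝ) :
    Measurable (eulerPath v x h) :=
  (measurable_from_nat (f := eulerNode v x h)).comp
    (Nat.measurable_floor.comp (measurable_id.div_const h))

theorem intervalIntegrable_comp (hv : Measurable fun q : ℝ × Pt d => v q.1 q.2)
    (hD : ∀ t z, ‖v t z‖ ≤ D) {y : ℝ → Pt d} (hy : Measurable y) (a b : ℝ) :
    IntervalIntegrable (fun s => v s (y s)) volume a b := by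
  have hm : Measurable fun s => v s (y s) := hv.comp (measurable_id.prodMk hy)
  refine (intervalIntegrable_const (c := D)).mono_fun hm.aestronglyMeasurable
    (Eventually.of_forall fun s => ?_)
  exact (hD s (y s)).trans (le_abs_self D)

theorem eulerPath_of_mem (hh : 0 < h) {k : ℕ} {s : ℝ} (hs : s ∈ Ico (k * h) ((k + 1) * h)) :
    eulerPath v x h s = eulerNode v x h k := by
  have : ⌊s / h⌋₊ = k := by
    rw [Nat.floor_eq_iff (div_nonneg ((by positivity : (0 : ℝ) ≤ k * h).trans hs.1) hh.le),
      le_div_iff₀ hh, div_lt_iff₀ hh]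
    exact hs
  rw [eulerPath, this]

/-- Only the position is frozen on a step, while the velocity is integrated in time. So the integral
equation is exact at the nodes, and measurability in time suffices. -/
theorem eulerNode_eq (hv : Measurable fun q : ℝ × Pt d => v q.1 q.2) (hD : ∀ t z, ‖v t z‖ ≤ D)
    (hh : 0 < h) (k : ℕ) :
    eulerNode v x h k = x + ∫ s in (0 : ℝ)..(k * h), v s (eulerPath v x h s) := by
  have hi := intervalIntegrable_comp hv hD (measurable_eulerPath v x h)
  induction k with
  | zero => simp [eulerNode]
  | succ k ih =>
    rw [eulerNode, Nat.cast_succ, ← intervalIntegral.integral_add_adjacent_intervals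
      (hi 0 (k * h)) (hi (k * h) ((k + 1) * h)), ← add_assoc, ← ih]
    congr 1
    refine intervalIntegral.integral_congr_Ioo_of_le (by nlinarith) fun s hs => ?_
    rw [eulerPath_of_mem hh ⟨hs.1.le, hs.2⟩]

theorem norm_eulerPath_sub_le (hv : Measurable fun q : ℝ × Pt d => v q.1 q.2)
    (hD : ∀ t z, ‖v t z‖ ≤ D) (hh : 0 < h) {t : ℝ} (ht : 0 ≤ t) :
    ‖eulerPath v x h t - x - ∫ s in (0 : ℝ)..t, v s (eulerPath v x h s)‖ ≤ D * h := by
  have hi := intervalIntegrable_comp hv hD (measurable_eulerPath v x h)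
  set k := ⌊t / h⌋₊ with hk
  have h1 : k * h ≤ t := by
    rw [← le_div_iff₀ hh]; exact Nat.floor_le (div_nonneg ht hh.le)
  have h2 : t ≤ (k + 1) * h := by
    rw [← div_le_iff₀ hh]; exact (Nat.lt_floor_add_one _).le
  have e : eulerPath v x h t - x - ∫ s in (0 : ℝ)..t, v s (eulerPath v x h s)
      = -∫ s in (k * h)..t, v s (eulerPath v x h s) := by
    rw [eulerPath, ← hk, eulerNode_eq hv hD hh k,
      ← intervalIntegral.integral_interval_sub_left (hi 0 t) (hi 0 (k * h))]
    abel
  rw [e, norm_neg]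
  refine (intervalIntegral.norm_integral_le_of_norm_le_const fun s _ => hD s _).trans ?_
  have hD0 : 0 ≤ D := (norm_nonneg _).trans (hD 0 0)
  rw [abs_of_nonneg (sub_nonneg.2 h1)]
  exact mul_le_mul_of_nonneg_left (by linarith) hD0

end euler

/-- Each Euler step shrinks the depth by a factor 1-l; this converts the product of the factors into
an exponential of elapsed time. -/
theorem exp_neg_two_mul_le {l : ℝ} (h0 : 0 ≤ l) (h1 : l ≤ 1 / 2) : Real.exp (-(2 * l)) ≤ 1 - l := by
  rw [Real.exp_neg, inv_le_comm₀ (Real.exp_pos _) (by linarith)]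
  refine le_trans ?_ (Real.add_one_le_exp (2 * l))
  rw [inv_le_iff_one_le_mul₀ (by linarith)]
  nlinarith

/-! ### Existence of the flow as a limit of Euler paths -/

section flow

variable {Ω : Set (Pt d)} {lo hi : ℝ} {p₀ p₁ : Pt d → ℝ}

/-- For times up to T the averaged velocity w of a step satisfies z + (1-T)w ∈ Ω, so the next node
is a convex combination of z and a point of Ω, with weight l = h/(1-T) on the latter. The resulting
depth is bounded below independently of the step size. -/
theorem closedBall_eulerNode_subset (hΩ : IsCompact Ω) (hc : Convex ℝ Ω) (hlo : 0 < lo)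
    (hp₀ : IsWeightOn Ω lo hi p₀) (hp₁ : IsWeightOn Ω lo hi p₁) {x : Pt d} {ε : ℝ} (hε : 0 < ε)
    (hx : Metric.closedBall x ε ⊆ Ω) {T h : ℝ} (hT : T < 1) (hh : 0 < h) (hhT : h ≤ (1 - T) / 2)
    (k : ℕ) (hk : k * h ≤ T) :
    Metric.closedBall (eulerNode (velocity Ω p₀ p₁) x h k)
      (ε * Real.exp (-(2 * (k * h / (1 - T))))) ⊆ Ω := by
  have hT1 : 0 < 1 - T := sub_pos.2 hT
  induction k with
  | zero => simpa [eulerNode] using hx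
  | succ k ih =>
    push_cast at hk ⊢
    have hkT : k * h ≤ T := by linarith
    have hk0 : 0 ≤ k * h := by positivity
    have ih := ih hkT
    set z := eulerNode (velocity Ω p₀ p₁) x h k with hz
    set ρ := ε * Real.exp (-(2 * (k * h / (1 - T)))) with hρ
    have hρ0 : 0 < ρ := by positivity
    have hzi : z ∈ interior Ω := mem_interior_of_closedBall_subset hρ0 ih
    have hzΩ : z ∈ Ω := interior_subset hzi
    set l := h / (1 - T) with hl
    have hl0 : 0 ≤ l := by positivity
    have hl2 : l ≤ 1 / 2 := by rw [hl, div_le_iff₀ hT1]; linarith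
    have hab : k * h < (k + 1) * h := by linarith
    set I := ∫ s in (k * h)..((k + 1) * h), velocity Ω p₀ p₁ s z with hI
    have hmem : h⁻¹ • I ∈ {w : Pt d | z + (1 - T) • w ∈ Ω} := by
      have e : h⁻¹ • I = ⨍ s in Ioc (k * h) ((k + 1) * h), velocity Ω p₀ p₁ s z := by
        have := interval_average_eq (fun s => velocity Ω p₀ p₁ s z) (k * h) ((k + 1) * h)
        rw [uIoc_of_le hab.le] at this
        rw [this, hI]; congr 2; ring
      rw [e]
      refine Convex.set_average_mem ?_ ?_ ?_ ?_ ?_ ?_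
      · intro a ha b hb r s hr hs hrs
        have := hc ha hb hr hs hrs
        change z + (1 - T) • (r • a + s • b) ∈ Ω
        convert this using 1
        nth_rewrite 1 [show z = r • z + s • z by rw [← add_smul, hrs, one_smul]]; module
      · exact hΩ.isClosed.preimage (by fun_prop)
      · simp [hh, add_mul]
      · simp
      · filter_upwards [ae_restrict_mem measurableSet_Ioc] with s hs
        have hs0 : 0 ≤ s := hk0.trans hs.1.le
        have hsT : s ≤ T := by linarith [hs.2]
        have hv := (velocity_mem_admissible hΩ hc hlo hp₀ hp₁ (t := s)
          ⟨hs0, by linarith⟩ hzi).2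
        have h1s : 0 < 1 - s := by linarith
        -- The point z + (1-T)v lies on the segment from z to z + (1-s)v, both in Ω; thus one target
        -- set serves all times of the step.
        have hr : (1 - T) / (1 - s) ≤ 1 := by rw [div_le_one h1s]; linarith
        have := hc hzΩ hv (sub_nonneg.2 hr) (by positivity) (sub_add_cancel 1 _)
        convert this using 1
        rw [smul_add, smul_smul, div_mul_cancel₀ _ h1s.ne']
        module
      · exact (intervalIntegrable_comp
          (measurable_velocity hΩ.measurableSet hp₀.continuousOn hp₁.continuousOn)
          (norm_velocity_le hΩ hlo hp₀ hp₁) (measurable_const (a := z)) _ _).1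
    have e : eulerNode (velocity Ω p₀ p₁) x h (k + 1)
        = (1 - l) • z + l • (z + (1 - T) • (h⁻¹ • I)) := by
      have : l * ((1 - T) * h⁻¹) = 1 := by rw [hl]; field_simp
      rw [eulerNode, ← hz, ← hI, smul_add, smul_smul, smul_smul, mul_assoc, this]
      module
    rw [e]
    refine (Metric.closedBall_subset_closedBall ?_).trans
      (closedBall_combo_subset hc ih hmem ⟨hl0, by linarith⟩)
    have e2 : Real.exp (-(2 * ((k + 1) * h / (1 - T))))
        = Real.exp (-(2 * l)) * Real.exp (-(2 * (k * h / (1 - T)))) := by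
      rw [← Real.exp_add]; congr 1; rw [hl]; ring
    rw [e2, hρ]
    have := exp_neg_two_mul_le hl0 hl2
    calc _ = Real.exp (-(2 * l)) * (ε * Real.exp (-(2 * (k * h / (1 - T))))) := by ring
      _ ≤ _ := mul_le_mul_of_nonneg_right this hρ0.le

theorem closedBall_eulerPath_subset (hΩ : IsCompact Ω) (hc : Convex ℝ Ω) (hlo : 0 < lo)
    (hp₀ : IsWeightOn Ω lo hi p₀) (hp₁ : IsWeightOn Ω lo hi p₁) {x : Pt d} {ε : ℝ} (hε : 0 < ε)
    (hx : Metric.closedBall x ε ⊆ Ω) {T h : ℝ} (hT : T < 1) (hh : 0 < h) (hhT : h ≤ (1 - T) / 2)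
    {t : ℝ} (ht : t ∈ Icc 0 T) :
    Metric.closedBall (eulerPath (velocity Ω p₀ p₁) x h t)
      (ε * Real.exp (-(2 / (1 - T)))) ⊆ Ω := by
  have hT1 : 0 < 1 - T := sub_pos.2 hT
  have h1 : ⌊t / h⌋₊ * h ≤ t := by
    rw [← le_div_iff₀ hh]; exact Nat.floor_le (div_nonneg ht.1 hh.le)
  refine (Metric.closedBall_subset_closedBall ?_).trans
    (closedBall_eulerNode_subset hΩ hc hlo hp₀ hp₁ hε hx hT hh hhT ⌊t / h⌋₊ (h1.trans ht.2))
  refine mul_le_mul_of_nonneg_left (Real.exp_le_exp.2 (neg_le_neg ?_)) hε.le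
  rw [← mul_div_assoc]
  exact div_le_div_of_nonneg_right (by linarith [ht.2]) hT1.le

/-- The Euler paths form a uniform Cauchy family on `[0, T]` for `T < 1`. -/
theorem exists_norm_eulerPath_sub_eulerPath_le (hΩ : IsCompact Ω) (hc : Convex ℝ Ω)
    (hlo : 0 < lo) (hp₀ : IsWeightOn Ω lo hi p₀) (hp₁ : IsWeightOn Ω lo hi p₁)
    (hω : IsOsgoodModulus (ratioModulus Ω p₀ p₁)) {x : Pt d} (hx : x ∈ interior Ω) {T : ℝ}
    (hT : T < 1) {θ : ℝ} (hθ : 0 < θ) :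
    ∃ η > 0, ∀ h h' : ℝ, 0 < h → h ≤ η → 0 < h' → h' ≤ η → ∀ t ∈ Icc 0 T,
      ‖eulerPath (velocity Ω p₀ p₁) x h' t - eulerPath (velocity Ω p₀ p₁) x h t‖ ≤ θ := by
  obtain ⟨ε, hε, hxε⟩ := exists_closedBall_subset hx
  have hne : Ω.Nonempty := ⟨x, interior_subset hx⟩
  have hT1 : 0 < 1 - T := sub_pos.2 hT
  set ρ := ε * Real.exp (-(2 / (1 - T))) with hρd
  have hρ : 0 < ρ := by positivity
  have hD0 : 0 ≤ Metric.diam Ω := Metric.diam_nonneg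
  have hK := oscConst_nonneg (lo := lo) (hi := hi) d hD0 (hp₀.div_nonneg hlo hne) hρ.le
  obtain ⟨a, ha, H⟩ := hω.exists_forall_le (T := T) hK hθ
  have hv := measurable_velocity hΩ.measurableSet hp₀.continuousOn hp₁.continuousOn
  have hD := norm_velocity_le hΩ hlo hp₀ hp₁
  -- The first bound keeps the paths inside Ω. The second makes their defects, at most diam(Ω)h and
  -- diam(Ω)h', add up to at most a; the +1 avoids division by zero.
  refine ⟨min ((1 - T) / 2) (a / (2 * Metric.diam Ω + 1)), by positivity, ?_⟩
  intro h h' hh hhη hh' hhη'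
  have b1 := hhη.trans (min_le_left _ _)
  have b1' := hhη'.trans (min_le_left _ _)
  have b2 := hhη.trans (min_le_right _ _)
  have b2' := hhη'.trans (min_le_right _ _)
  set y := eulerPath (velocity Ω p₀ p₁) x h with hy
  set y' := eulerPath (velocity Ω p₀ p₁) x h' with hy'
  have my : Measurable y := measurable_eulerPath _ _ _
  have my' : Measurable y' := measurable_eulerPath _ _ _
  have hball : ∀ t ∈ Icc 0 T, Metric.closedBall (y t) ρ ⊆ Ω := fun t ht =>
    closedBall_eulerPath_subset hΩ hc hlo hp₀ hp₁ hε hxε hT hh b1 ht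
  have hball' : ∀ t ∈ Icc 0 T, Metric.closedBall (y' t) ρ ⊆ Ω := fun t ht =>
    closedBall_eulerPath_subset hΩ hc hlo hp₀ hp₁ hε hxε hT hh' b1' ht
  have hm : Measurable ((Icc 0 T).indicator fun t => ‖y' t - y t‖) :=
    (my'.sub my).norm.indicator measurableSet_Icc
  have hB : ∀ t ∈ Icc 0 T, ‖y' t - y t‖ ≤ Metric.diam Ω := by
    intro t ht
    rw [← dist_eq_norm]
    exact Metric.dist_le_diam_of_mem hΩ.isBounded
      (hball' t ht (Metric.mem_closedBall_self hρ.le)) (hball t ht (Metric.mem_closedBall_self hρ.le))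
  refine H (fun t => ‖y' t - y t‖) _ hm (fun _ _ => norm_nonneg _) hB fun t ht => ?_
  have key := hω.norm_sub_le_integral (y := y) (y' := y') (e := 0) (a := a)
    (V := fun s => velocity Ω p₀ p₁ s (y s)) (V' := fun s => velocity Ω p₀ p₁ s (y' s))
    le_rfl hK hm hB (fun s hs => ?_) (fun s hs => ?_) ht
  · simpa using key
  · have i := intervalIntegrable_comp hv hD my 0 s
    have i' := intervalIntegrable_comp hv hD my' 0 s
    have n := norm_eulerPath_sub_le (x := x) hv hD hh hs.1
    have n' := norm_eulerPath_sub_le (x := x) hv hD hh' hs.1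
    rw [intervalIntegral.integral_sub i' i]
    have e : y' s - y s - ((∫ r in (0 : ℝ)..s, velocity Ω p₀ p₁ r (y' r)) -
        ∫ r in (0 : ℝ)..s, velocity Ω p₀ p₁ r (y r)) =
        (y' s - x - ∫ r in (0 : ℝ)..s, velocity Ω p₀ p₁ r (y' r)) -
        (y s - x - ∫ r in (0 : ℝ)..s, velocity Ω p₀ p₁ r (y r)) := by abel
    rw [e]
    refine (norm_sub_le _ _).trans ((add_le_add n' n).trans ?_)
    rw [le_div_iff₀ (by positivity)] at b2 b2'
    nlinarith
  · rw [zero_add]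
    exact norm_velocity_sub_le_oscConst hΩ hc hlo hp₀ hp₁ ⟨hs.1, hs.2.le.trans hT.le⟩ hρ
      (hball s ⟨hs.1, hs.2.le⟩)

theorem tendsto_velocity (hΩ : IsCompact Ω) (hc : Convex ℝ Ω) (hlo : 0 < lo)
    (hp₀ : IsWeightOn Ω lo hi p₀) (hp₁ : IsWeightOn Ω lo hi p₁)
    (hω : IsOsgoodModulus (ratioModulus Ω p₀ p₁)) {t : ℝ} (ht : t ∈ Icc (0 : ℝ) 1) {z : Pt d}
    (hz : z ∈ interior Ω) {w : ℕ → Pt d} (hw : Tendsto w atTop (𝓝 z)) :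
    Tendsto (fun n => velocity Ω p₀ p₁ t (w n)) atTop (𝓝 (velocity Ω p₀ p₁ t z)) := by
  obtain ⟨ρ, hρ, hb⟩ := exists_closedBall_subset hz
  set K := oscConst d (Metric.diam Ω) lo hi ρ
  have hK : 0 ≤ K := oscConst_nonneg d Metric.diam_nonneg
    (hp₀.div_nonneg hlo ⟨z, interior_subset hz⟩) hρ.le
  have hlim := hω.osgood.tendsto_zero hω.mono hω.nonneg
  rw [Metric.tendsto_nhds]
  intro c hcpos
  have h1 : ∀ᶠ u in 𝓝[>] (0 : ℝ), K * (u + ratioModulus Ω p₀ p₁ u) < c := by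
    have : Tendsto (fun u => K * (u + ratioModulus Ω p₀ p₁ u)) (𝓝[>] 0) (𝓝 (K * (0 + 0))) :=
      ((tendsto_nhdsWithin_of_tendsto_nhds tendsto_id).add hlim).const_mul K
    rw [add_zero, mul_zero] at this
    exact this.eventually_lt_const hcpos
  obtain ⟨s, hs, hs0⟩ := (h1.and self_mem_nhdsWithin).exists
  filter_upwards [(Metric.tendsto_nhds.1 hw) s hs0] with n hn
  rw [dist_eq_norm] at hn ⊢
  refine ((norm_velocity_sub_le_oscConst hΩ hc hlo hp₀ hp₁ ht (z' := w n) hρ hb).trans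
    (mul_le_mul_of_nonneg_left (add_le_add hn.le (hω.mono hn.le)) hK)).trans_lt hs

/-- A pointwise limit of Euler paths solves the integral equation. -/
theorem isSolution_of_tendsto_eulerPath {v : ℝ → Pt d → Pt d} {x : Pt d} {D : ℝ}
    (hv : Measurable fun q : ℝ × Pt d => v q.1 q.2) (hD : ∀ t z, ‖v t z‖ ≤ D)
    {h : ℕ → ℝ} (h0 : ∀ n, 0 < h n) (hlim : Tendsto h atTop (𝓝 0)) {L : ℝ → Pt d}
    (hL : ∀ t ∈ Ico (0 : ℝ) 1, Tendsto (fun n => eulerPath v x (h n) t) atTop (𝓝 (L t)))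
    (hint : ∀ t ∈ Ico (0 : ℝ) 1, L t ∈ interior Ω)
    (hvL : ∀ t ∈ Ico (0 : ℝ) 1,
      Tendsto (fun n => v t (eulerPath v x (h n) t)) atTop (𝓝 (v t (L t)))) :
    IsSolution Ω v x 1 fun t => x + ∫ s in (0 : ℝ)..t, v s (L s) := by
  have hae : ∀ t ∈ Icc (0 : ℝ) 1, ∀ᵐ s ∂(volume : Measure ℝ), s ∈ uIoc 0 t →
      Tendsto (fun n => v s (eulerPath v x (h n) s)) atTop (𝓝 (v s (L s))) := by
    intro t ht
    filter_upwards [Measure.ae_ne volume (1 : ℝ)] with s hs hst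
    rw [uIoc_of_le ht.1] at hst
    exact hvL s ⟨hst.1.le, lt_of_le_of_ne (hst.2.trans ht.2) hs⟩
  have hmeas : ∀ n, Measurable fun s => v s (eulerPath v x (h n) s) := fun n =>
    hv.comp (measurable_id.prodMk (measurable_eulerPath v x (h n)))
  have hintL : IntervalIntegrable (fun s => v s (L s)) volume 0 1 := by
    refine (intervalIntegrable_const (c := D)).mono_fun ?_ (Eventually.of_forall fun s => ?_)
    · refine aestronglyMeasurable_of_tendsto_ae atTop
        (fun n => (hmeas n).aestronglyMeasurable) ?_
      exact (ae_restrict_iff' measurableSet_uIoc).2 (hae 1 ⟨zero_le_one, le_rfl⟩)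
    · exact (hD s (L s)).trans (le_abs_self _)
  have hLeq : ∀ t ∈ Ico (0 : ℝ) 1, L t = x + ∫ s in (0 : ℝ)..t, v s (L s) := by
    intro t ht
    have l1 : Tendsto (fun n => ∫ s in (0 : ℝ)..t, v s (eulerPath v x (h n) s)) atTop
        (𝓝 (∫ s in (0 : ℝ)..t, v s (L s))) :=
      intervalIntegral.tendsto_integral_filter_of_dominated_convergence (fun _ => D)
        (Eventually.of_forall fun n => (hmeas n).aestronglyMeasurable)
        (Eventually.of_forall fun n => Eventually.of_forall fun s _ => hD s _)
        intervalIntegrable_const (hae t ⟨ht.1, ht.2.le⟩)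
    have l2 : Tendsto (fun n => eulerPath v x (h n) t - x -
        ∫ s in (0 : ℝ)..t, v s (eulerPath v x (h n) s)) atTop (𝓝 0) := by
      refine squeeze_zero_norm (fun n => norm_eulerPath_sub_le hv hD (h0 n) ht.1) ?_
      simpa using hlim.const_mul D
    have l3 := tendsto_nhds_unique l2 (((hL t ht).sub_const x).sub l1)
    rw [sub_sub, eq_comm, sub_eq_zero] at l3
    exact l3
  -- The candidate is the integral along L, not L itself: they agree before time 1, where L is known
  -- to be the limit, and the integral also supplies the value at 1.
  refine ⟨fun t ht => hLeq t ht ▸ hint t ht, ?_, fun t ht => ?_⟩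
  · refine hintL.congr_ae ?_
    refine (ae_restrict_iff' measurableSet_uIoc).2 ?_
    filter_upwards [Measure.ae_ne volume (1 : ℝ)] with s hs hst
    rw [uIoc_of_le zero_le_one] at hst
    rw [← hLeq s ⟨hst.1.le, lt_of_le_of_ne hst.2 hs⟩]
  · refine congrArg (x + ·) (intervalIntegral.integral_congr_Ioo_of_le ht.1 fun s hs => ?_)
    exact congrArg (v s) (hLeq s ⟨hs.1.le, hs.2.trans_le ht.2⟩)

theorem exists_tendsto_eulerPath (hΩ : IsCompact Ω) (hc : Convex ℝ Ω) (hlo : 0 < lo)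
    (hp₀ : IsWeightOn Ω lo hi p₀) (hp₁ : IsWeightOn Ω lo hi p₁)
    (hω : IsOsgoodModulus (ratioModulus Ω p₀ p₁)) {x : Pt d} (hx : x ∈ interior Ω)
    {h : ℕ → ℝ} (h0 : ∀ n, 0 < h n) (hlim : Tendsto h atTop (𝓝 0)) {t : ℝ}
    (ht : t ∈ Ico (0 : ℝ) 1) :
    ∃ l ∈ interior Ω, Tendsto (fun n => eulerPath (velocity Ω p₀ p₁) x (h n) t) atTop (𝓝 l) := by
  obtain ⟨ε, hε, hxε⟩ := exists_closedBall_subset hx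
  have hT1 : 0 < 1 - t := sub_pos.2 ht.2
  have hcau : CauchySeq fun n => eulerPath (velocity Ω p₀ p₁) x (h n) t := by
    rw [Metric.cauchySeq_iff]
    intro θ hθ
    obtain ⟨η, hη, H⟩ := exists_norm_eulerPath_sub_eulerPath_le hΩ hc hlo hp₀ hp₁ hω hx ht.2
      (half_pos hθ)
    obtain ⟨N, hN⟩ := eventually_atTop.1 (hlim.eventually_le_const hη)
    refine ⟨N, fun m hm n hn => ?_⟩
    rw [dist_eq_norm]
    exact (H (h n) (h m) (h0 n) (hN n hn) (h0 m) (hN m hm) t ⟨ht.1, le_rfl⟩).trans_lt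
      (half_lt_self hθ)
  obtain ⟨l, hl⟩ := cauchySeq_tendsto_of_complete hcau
  have hρ : 0 < ε * Real.exp (-(2 / (1 - t))) := by positivity
  refine ⟨l, mem_interior_of_closedBall_subset hρ fun w hw => ?_, hl⟩
  have hlim' := hl.add_const (w - l)
  rw [add_sub_cancel] at hlim'
  refine hΩ.isClosed.mem_of_tendsto hlim' ?_
  filter_upwards [hlim.eventually_le_const (half_pos hT1)] with n hn
  refine closedBall_eulerPath_subset hΩ hc hlo hp₀ hp₁ hε hxε ht.2 (h0 n) hn ⟨ht.1, le_rfl⟩ ?_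
  rw [mem_closedBall_iff_norm] at hw ⊢
  rwa [add_sub_cancel_left]

/-- Existence of the flow up to time `1`. -/
theorem exists_isSolution (hΩ : IsCompact Ω) (hc : Convex ℝ Ω) (hlo : 0 < lo)
    (hp₀ : IsWeightOn Ω lo hi p₀) (hp₁ : IsWeightOn Ω lo hi p₁)
    (hω : IsOsgoodModulus (ratioModulus Ω p₀ p₁)) {x : Pt d} (hx : x ∈ interior Ω) :
    ∃ y, IsSolution Ω (velocity Ω p₀ p₁) x 1 y := by
  have h0 : ∀ n : ℕ, 0 < 1 / ((n : ℝ) + 1) := fun n => by positivity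
  have hex : ∀ t, ∃ l, t ∈ Ico (0 : ℝ) 1 → l ∈ interior Ω ∧
      Tendsto (fun n : ℕ => eulerPath (velocity Ω p₀ p₁) x (1 / ((n : ℝ) + 1)) t) atTop (𝓝 l) := by
    intro t
    by_cases ht : t ∈ Ico (0 : ℝ) 1
    · obtain ⟨l, hl⟩ := exists_tendsto_eulerPath hΩ hc hlo hp₀ hp₁ hω hx h0
        tendsto_one_div_add_atTop_nhds_zero_nat ht
      exact ⟨l, fun _ => hl⟩
    · exact ⟨0, fun h => absurd h ht⟩
  choose L hL using hex
  exact ⟨_, isSolution_of_tendsto_eulerPath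
    (measurable_velocity hΩ.measurableSet hp₀.continuousOn hp₁.continuousOn)
    (norm_velocity_le hΩ hlo hp₀ hp₁) h0 tendsto_one_div_add_atTop_nhds_zero_nat
    (fun t ht => (hL t ht).2) (fun t ht => (hL t ht).1)
    fun t ht => tendsto_velocity hΩ hc hlo hp₀ hp₁ hω ⟨ht.1, ht.2.le⟩ (hL t ht).1 (hL t ht).2⟩

theorem hasUniqueFlow_velocity (hΩ : IsCompact Ω) (hc : Convex ℝ Ω) (hlo : 0 < lo)
    (hp₀ : IsWeightOn Ω lo hi p₀) (hp₁ : IsWeightOn Ω lo hi p₁)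
    (hω : IsOsgoodModulus (ratioModulus Ω p₀ p₁)) {x : Pt d} (hx : x ∈ interior Ω) :
    HasUniqueFlow Ω (velocity Ω p₀ p₁) x := by
  obtain ⟨y, hy⟩ := exists_isSolution hΩ hc hlo hp₀ hp₁ hω hx
  exact ⟨y, hy, fun T hT y' hy' =>
    (hy.mono hT.1.le hT.2).eqOn hΩ hc hlo hp₀ hp₁ hω hx hT.2 hy'⟩

end flow

/-! ### Stability of the flow -/

section stability

variable {Ω : Set (Pt d)} {lo hi : ℝ} {p₀ p₁ q₀ q₁ : Pt d → ℝ}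

/-- A frontier point p lies in Ω at distance at least ε from x; prolonging the segment from p by ε
beyond x stays in Ω. This keeps ln(diam(Ω)/ε) at least ln 2. -/
theorem two_mul_le_diam (hΩ : IsCompact Ω) (hfr : (frontier Ω).Nonempty) {x : Pt d} {ε : ℝ}
    (hε : 0 < ε) (hx : Metric.closedBall x ε ⊆ Ω) : 2 * ε ≤ Metric.diam Ω := by
  obtain ⟨p, hp⟩ := hfr
  rw [hΩ.isClosed.frontier_eq] at hp
  have h1 : ε ≤ ‖x - p‖ := by
    by_contra! hcon
    refine hp.2 (interior_mono hx (Metric.ball_subset_interior_closedBall ?_))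
    rwa [mem_ball_iff_norm, norm_sub_rev]
  have h0 : 0 < ‖x - p‖ := hε.trans_le h1
  have hw : x + (ε / ‖x - p‖) • (x - p) ∈ Ω := by
    refine hx ?_
    rw [mem_closedBall_iff_norm, add_sub_cancel_left, norm_smul,
      Real.norm_of_nonneg (by positivity), div_mul_cancel₀ _ h0.ne']
  have h2 := Metric.dist_le_diam_of_mem hΩ.isBounded hw hp.1
  have e : x + (ε / ‖x - p‖) • (x - p) - p = (1 + ε / ‖x - p‖) • (x - p) := by module
  rw [dist_eq_norm, e, norm_smul, Real.norm_of_nonneg (by positivity), add_mul, one_mul,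
    div_mul_cancel₀ _ h0.ne'] at h2
  linarith

theorem logRatio_nonneg (p₀ p₁ q₀ q₁ : Pt d → ℝ) (x : Pt d) : 0 ≤ logRatio p₀ p₁ q₀ q₁ x :=
  (abs_nonneg _).trans (le_max_left _ _)

theorem logRatioError_nonneg (Ω : Set (Pt d)) (p₀ p₁ q₀ q₁ : Pt d → ℝ) :
    0 ≤ logRatioError Ω p₀ p₁ q₀ q₁ := by
  refine Real.sSup_nonneg ?_
  rintro _ ⟨x, -, rfl⟩
  exact logRatio_nonneg _ _ _ _ x

theorem logRatio_le_logRatioError (h : BddAbove (logRatio p₀ p₁ q₀ q₁ '' Ω)) {x : Pt d}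
    (hx : x ∈ Ω) : logRatio p₀ p₁ q₀ q₁ x ≤ logRatioError Ω p₀ p₁ q₀ q₁ :=
  le_csSup h ⟨x, hx, rfl⟩

theorem mem_Icc_of_abs_log_div_le {p q r : ℝ} (hlo : 0 < lo) (hp : p ∈ Icc lo hi) (hq : 0 < q)
    (h : |Real.log (q / p)| ≤ r) : q ∈ Icc (lo * Real.exp (-r)) (hi * Real.exp r) := by
  have hp0 : 0 < p := hlo.trans_le hp.1
  rw [abs_le, Real.le_log_iff_exp_le (div_pos hq hp0), Real.log_le_iff_le_exp (div_pos hq hp0),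
    le_div_iff₀ hp0, div_le_iff₀ hp0] at h
  have e1 := Real.exp_pos r
  have e2 := Real.exp_pos (-r)
  exact ⟨by nlinarith [h.1, hp.1], by nlinarith [h.2, hp.2]⟩

theorem isBoundedPair_of_logRatio_le {r : ℝ} (hlo : 0 < lo) (hp : IsBoundedPair Ω lo hi p₀ p₁)
    (hq₀ : ∀ x ∈ Ω, 0 < q₀ x) (hq₁ : ∀ x ∈ Ω, 0 < q₁ x)
    (hr : ∀ x ∈ Ω, logRatio p₀ p₁ q₀ q₁ x ≤ r) :
    IsBoundedPair Ω (lo * Real.exp (-r)) (hi * Real.exp r) q₀ q₁ := by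
  have k0 : ∀ x ∈ Ω, q₀ x ∈ Icc (lo * Real.exp (-r)) (hi * Real.exp r) := fun x hx =>
    mem_Icc_of_abs_log_div_le hlo ⟨hp.lower₀ x hx, hp.upper₀ x hx⟩ (hq₀ x hx)
      ((le_max_left _ _).trans (hr x hx))
  have k1 : ∀ x ∈ Ω, q₁ x ∈ Icc (lo * Real.exp (-r)) (hi * Real.exp r) := fun x hx =>
    mem_Icc_of_abs_log_div_le hlo ⟨hp.lower₁ x hx, hp.upper₁ x hx⟩ (hq₁ x hx)
      ((le_max_right _ _).trans (hr x hx))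
  exact ⟨fun x hx => (k0 x hx).1, fun x hx => (k0 x hx).2, fun x hx => (k1 x hx).1,
    fun x hx => (k1 x hx).2⟩

/-- A path which starts and ends well inside `Ω` stays well inside. -/
theorem IsSolution.closedBall_min_subset (hΩ : IsCompact Ω) (hc : Convex ℝ Ω) (hlo : 0 < lo)
    (hp₀ : IsWeightOn Ω lo hi p₀) (hp₁ : IsWeightOn Ω lo hi p₁) {x : Pt d} {ε γ : ℝ}
    (hε : 0 < ε) (hγ : 0 < γ) (hx : Metric.closedBall x ε ⊆ Ω) {R : ℝ → Pt d}
    (hR : IsSolution Ω (velocity Ω p₀ p₁) x 1 R)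
    (hend : 2 * γ ≤ Metric.infDist (R 1) (frontier Ω)) {t : ℝ} (ht : t ∈ Icc (0 : ℝ) 1) :
    Metric.closedBall (R t) (min ε γ / 2) ⊆ Ω := by
  have hne : Ω.Nonempty := ⟨x, hx (Metric.mem_closedBall_self hε.le)⟩
  have h1 := fun s hs => hR.closedBall_subset hΩ hc hlo hp₀ hp₁ hne hx le_rfl (t := s) hs
  have hR1 : R 1 ∈ Ω := h1 1 ⟨zero_le_one, le_rfl⟩ (Metric.mem_closedBall_self (by simp))
  have hb := closedBall_subset_of_le_infDist hΩ.isClosed hR1 hγ hend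
  have m1 := min_le_left ε γ
  have m2 := min_le_right ε γ
  -- In the first half the starting depth counts, (1-t)ε ≥ ε/2; in the second the final depth, tγ ≥
  -- γ/2.
  rcases le_total t (1 / 2) with h | h
  · exact (Metric.closedBall_subset_closedBall (by nlinarith)).trans (h1 t ht)
  · exact (Metric.closedBall_subset_closedBall (by nlinarith)).trans
      (hR.closedBall_subset_of_end hΩ hc hlo hp₀ hp₁ hne hb ht)

/-- Stability of the flow in terms of `Ψ`. -/
theorem IsSolution.end_eq_or_psiReal_le {lo' hi' r : ℝ} (hΩ : IsCompact Ω) (hc : Convex ℝ Ω)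
    (hlo : 0 < lo) (hlo' : 0 < lo') (hp₀ : IsWeightOn Ω lo hi p₀) (hp₁ : IsWeightOn Ω lo hi p₁)
    (hω : IsOsgoodModulus (ratioModulus Ω p₀ p₁))
    (hq₀ : IsWeightOn Ω lo' hi' q₀) (hq₁ : IsWeightOn Ω lo' hi' q₁)
    (hr : ∀ x ∈ Ω, logRatio p₀ p₁ q₀ q₁ x ≤ r) (hr0 : 0 ≤ r) {x : Pt d} {ρ : ℝ}
    (hρ : 0 < ρ) {R R' : ℝ → Pt d} (hR : IsSolution Ω (velocity Ω p₀ p₁) x 1 R)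
    (hR' : IsSolution Ω (velocity Ω q₀ q₁) x 1 R')
    (hball : ∀ t ∈ Icc (0 : ℝ) 1, Metric.closedBall (R t) ρ ⊆ Ω) :
    ‖R' 1 - R 1‖ = 0 ∨ 0 < 2 * Metric.diam Ω * (Real.exp (4 * r) - 1) ∧ 0 < ‖R' 1 - R 1‖ ∧
      psiReal (ratioModulus Ω p₀ p₁) ‖R' 1 - R 1‖ ≤
        psiReal (ratioModulus Ω p₀ p₁) (2 * Metric.diam Ω * (Real.exp (4 * r) - 1)) +
          oscConst d (Metric.diam Ω) lo hi ρ := by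
  have h1 : (1 : ℝ) ∈ Icc (0 : ℝ) 1 := ⟨zero_le_one, le_rfl⟩
  have hne : Ω.Nonempty := ⟨R 1, hball 1 h1 (Metric.mem_closedBall_self hρ.le)⟩
  have hD : 0 ≤ Metric.diam Ω := Metric.diam_nonneg
  have hK := oscConst_nonneg (lo := lo) (hi := hi) d hD (hp₀.div_nonneg hlo hne) hρ.le
  have c := hR.continuousOn zero_le_one
  have c' := hR'.continuousOn zero_le_one
  obtain ⟨B, hB⟩ := exists_norm_sub_le c c'
  have hm := measurable_indicator_norm_sub c c'
  set a := 2 * Metric.diam Ω * (Real.exp (4 * r) - 1) with ha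
  have ha0 : 0 ≤ a := mul_nonneg (by positivity) (sub_nonneg.2 (Real.one_le_exp (by positivity)))
  have hle : ∀ s ∈ Ico (0 : ℝ) 1, ‖velocity Ω q₀ q₁ s (R' s) - velocity Ω p₀ p₁ s (R s)‖ ≤
      a + oscConst d (Metric.diam Ω) lo hi ρ *
        (‖R' s - R s‖ + ratioModulus Ω p₀ p₁ ‖R' s - R s‖) := by
    intro s hs
    have hs' : s ∈ Icc (0 : ℝ) 1 := ⟨hs.1, hs.2.le⟩
    have e1 := norm_velocity_sub_velocity_le hΩ hlo hlo' hp₀ hp₁ hq₀ hq₁ hr hs'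
      (hR'.mem_interior s hs)
    have e2 := norm_velocity_sub_le_oscConst hΩ hc hlo hp₀ hp₁ hs' (z' := R' s) hρ (hball s hs')
    -- The argument gives e^{2r}; the exponent 4r of the statement is weaker.
    have e3 : 2 * Metric.diam Ω * (Real.exp (2 * r) - 1) ≤ a := by
      refine mul_le_mul_of_nonneg_left ?_ (by positivity)
      linarith [Real.exp_le_exp.2 (show 2 * r ≤ 4 * r by linarith)]
    exact (norm_sub_le_norm_sub_add_norm_sub _ (velocity Ω p₀ p₁ s (R' s)) _).trans
      (add_le_add (e1.trans e3) e2)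
  have key : ∀ t ∈ Icc (0 : ℝ) 1, ‖R' t - R t‖ ≤ a + ∫ s in (0 : ℝ)..t,
      oscConst d (Metric.diam Ω) lo hi ρ *
        (‖R' s - R s‖ + ratioModulus Ω p₀ p₁ ‖R' s - R s‖) := by
    intro t ht
    have := hω.norm_sub_le_integral (a := 0) ha0 hK hm hB
      (fun t ht => norm_le_zero_iff.2 (hR.sub_sub_integral hR' ht)) hle ht
    simpa using this
  rcases (norm_nonneg (R' 1 - R 1)).eq_or_lt with h0 | h0
  · exact Or.inl h0.symm
  -- For a = 0 the real-valued Ψ(a) is not the intended -∞, so the paths are shown to coincide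
  -- directly.
  rcases ha0.eq_or_lt with ha1 | ha1
  · left
    rw [← ha1] at key
    simp only [zero_add] at key
    exact hω.eq_zero hK hm (fun _ _ => norm_nonneg _) hB key h1
  · refine Or.inr ⟨ha1, h0, ?_⟩
    have := hω.psiReal_le_of_Icc ha1 hK hm (fun _ _ => norm_nonneg _) hB key h1 h0
    simpa using this

end stability

/-! ### The constant and the conclusion -/

/-- The constant of the stability estimate. -/
noncomputable def stabilityConst (d : ℕ) (D lo hi : ℝ) : ℝ :=
  2 * |D| * |velocityConst d lo hi| * (|D| + 2) / Real.log 2 + 1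

theorem stabilityConst_pos (d : ℕ) (D lo hi : ℝ) : 0 < stabilityConst d D lo hi := by
  have := Real.log_pos one_lt_two
  unfold stabilityConst
  positivity

theorem oscConst_le {d : ℕ} {D lo hi ε γ : ℝ} (hε : 0 < ε) (hγ : 0 < γ) (hD : 2 * ε ≤ D) :
    oscConst d D lo hi (min ε γ / 2) ≤
      stabilityConst d D lo hi / min ε γ * Real.log (D / ε) +
        stabilityConst d D lo hi / (ε * γ) := by
  have hC := stabilityConst_pos d D lo hi
  have hμ : 0 < min ε γ := lt_min hε hγ
  have hD0 : 0 < D := by linarith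
  have hl2 := Real.log_pos one_lt_two
  have hlog : Real.log 2 ≤ Real.log (D / ε) :=
    Real.log_le_log two_pos (by rw [le_div_iff₀ hε]; exact hD)
  have hμD : min ε γ ≤ D := (min_le_left _ _).trans (by linarith)
  have h1 : 1 + (min ε γ / 2)⁻¹ ≤ (D + 2) / min ε γ := by
    rw [inv_div, add_div]
    gcongr
    rwa [one_le_div hμ]
  set c := |velocityConst d lo hi|
  have hc : 0 ≤ c := abs_nonneg _
  calc oscConst d D lo hi (min ε γ / 2) ≤ 2 * D * c * ((D + 2) / min ε γ) := by
        unfold oscConst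
        gcongr
        exact le_abs_self _
    -- The factor ln 2 is inserted to be enlarged to ln(D/ε). The term in 1/(εγ) is not needed.
    _ = 2 * D * c * (D + 2) / Real.log 2 / min ε γ * Real.log 2 := by field_simp
    _ ≤ stabilityConst d D lo hi / min ε γ * Real.log (D / ε) := by
        gcongr
        rw [stabilityConst, abs_of_pos hD0]
        exact le_add_of_nonneg_right zero_le_one
    _ ≤ _ := le_add_of_nonneg_right (by positivity)

end RectifiedFlow

theorem mainTheorem6 (d : ℕ) (D lo hi : ℝ) (hlo : 0 < lo) :
    ∃ C : ℝ, 0 < C ∧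
      ∀ (Ω : Set (RectifiedFlow.Pt d)) (p₀ p₁ q₀ q₁ : RectifiedFlow.Pt d → ℝ),
        -- the bounded case
        IsCompact Ω → Convex ℝ Ω → (interior Ω).Nonempty → Metric.diam Ω = D →
        RectifiedFlow.IsDensityOn Ω lo hi p₀ → RectifiedFlow.IsDensityOn Ω lo hi p₁ →
        RectifiedFlow.IsOsgood (RectifiedFlow.ratioModulus Ω p₀ p₁) →
        -- the density estimators `q₀`, `q₁`
        (∀ x ∈ Ω, 0 < q₀ x) → (∀ x ∈ Ω, 0 < q₁ x) →
        BddAbove (RectifiedFlow.logRatio p₀ p₁ q₀ q₁ '' Ω) →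
        RectifiedFlow.IsOsgood (RectifiedFlow.ratioModulus Ω q₀ q₁) →
        -- both flows are uniquely defined
        (∀ x ∈ interior Ω, RectifiedFlow.HasUniqueFlow Ω (RectifiedFlow.velocity Ω p₀ p₁) x) ∧
        (∀ x ∈ interior Ω, RectifiedFlow.HasUniqueFlow Ω (RectifiedFlow.velocity Ω q₀ q₁) x) ∧
        -- error bounds; `R` is the path of the flow from `x`, `R'` that of the estimated flow
        ∀ (ε γ : ℝ), 0 < ε → 0 < γ → ∀ x ∈ RectifiedFlow.erosion Ω ε,
          ∀ R R' : ℝ → RectifiedFlow.Pt d,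
            RectifiedFlow.IsSolution Ω (RectifiedFlow.velocity Ω p₀ p₁) x 1 R →
            RectifiedFlow.IsSolution Ω (RectifiedFlow.velocity Ω q₀ q₁) x 1 R' →
            2 * γ ≤ Metric.infDist (R 1) (frontier Ω) →
            ‖R' 1 - R 1‖ ≤
              RectifiedFlow.psiInv (RectifiedFlow.ratioModulus Ω p₀ p₁)
                (RectifiedFlow.psi (RectifiedFlow.ratioModulus Ω p₀ p₁)
                    (2 * Metric.diam Ω *
                      (Real.exp (4 * RectifiedFlow.logRatioError Ω p₀ p₁ q₀ q₁) - 1)) +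
                  ((C / min ε γ * Real.log (Metric.diam Ω / ε) + C / (ε * γ) : ℝ) : EReal)) ∧
            ∀ L : ℝ, (∀ u : ℝ, 0 ≤ u → RectifiedFlow.ratioModulus Ω p₀ p₁ u ≤ L * u) →
              ‖R' 1 - R 1‖ ≤
                2 * Metric.diam Ω *
                    (Real.exp (4 * RectifiedFlow.logRatioError Ω p₀ p₁ q₀ q₁) - 1) *
                  Real.exp (C * (L + 1) / min ε γ * Real.log (Metric.diam Ω / ε) +
                    C * (L + 1) / (ε * γ)) := by
  refine ⟨RectifiedFlow.stabilityConst d D lo hi, RectifiedFlow.stabilityConst_pos d D lo hi, ?_⟩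
  intro Ω p₀ p₁ q₀ q₁ hΩ hc hint hdiam hd₀ hd₁ hosg hq₀ hq₁ hbdd hosg'
  have hne : Ω.Nonempty := hint.mono interior_subset
  have hp₀ := hd₀.isWeightOn
  have hp₁ := hd₁.isWeightOn
  have hpp := hp₀.isBoundedPair hp₁
  have hω := hpp.isOsgoodModulus hlo hc hne hosg
  set r := RectifiedFlow.logRatioError Ω p₀ p₁ q₀ q₁
  have hr0 : 0 ≤ r := RectifiedFlow.logRatioError_nonneg Ω p₀ p₁ q₀ q₁
  have hr : ∀ x ∈ Ω, RectifiedFlow.logRatio p₀ p₁ q₀ q₁ x ≤ r := fun x hx =>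
    RectifiedFlow.logRatio_le_logRatioError hbdd hx
  have hqq := RectifiedFlow.isBoundedPair_of_logRatio_le hlo hpp hq₀ hq₁ hr
  have hlo' : 0 < lo * Real.exp (-r) := mul_pos hlo (Real.exp_pos _)
  have hω' := hqq.isOsgoodModulus hlo' hc hne hosg'
  have hcq := hqq.continuousOn hlo' hosg'
  have hw₀ : RectifiedFlow.IsWeightOn Ω (lo * Real.exp (-r)) (hi * Real.exp r) q₀ :=
    ⟨hcq.1, hqq.lower₀, hqq.upper₀⟩
  have hw₁ : RectifiedFlow.IsWeightOn Ω (lo * Real.exp (-r)) (hi * Real.exp r) q₁ :=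
    ⟨hcq.2, hqq.lower₁, hqq.upper₁⟩
  refine ⟨fun x hx => RectifiedFlow.hasUniqueFlow_velocity hΩ hc hlo hp₀ hp₁ hω hx,
    fun x hx => RectifiedFlow.hasUniqueFlow_velocity hΩ hc hlo' hw₀ hw₁ hω' hx, ?_⟩
  intro ε γ hε hγ x hx R R' hR hR' hend
  have hμ : 0 < min ε γ := lt_min hε hγ
  -- The distance to an empty frontier is 0 by convention, which contradicts γ > 0.
  have hfr : (frontier Ω).Nonempty := by
    rw [Set.nonempty_iff_ne_empty]
    intro h
    rw [h, Metric.infDist_empty] at hend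
    linarith
  have hb := RectifiedFlow.oscConst_le (d := d) (lo := lo) (hi := hi) hε hγ
    (RectifiedFlow.two_mul_le_diam hΩ hfr hε hx)
  rw [hdiam] at hb
  have hstab := hR.end_eq_or_psiReal_le hΩ hc hlo hlo' hp₀ hp₁ hω hw₀ hw₁ hr hr0
    (half_pos hμ) hR' fun t ht =>
      hR.closedBall_min_subset hΩ hc hlo hp₀ hp₁ hε hγ hx hend ht
  rw [hdiam] at hstab ⊢
  set C := RectifiedFlow.stabilityConst d D lo hi
  set a := 2 * D * (Real.exp (4 * r) - 1) with ha
  have hD : 0 ≤ D := hdiam ▸ Metric.diam_nonneg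
  have ha0 : 0 ≤ a := mul_nonneg (by positivity) (sub_nonneg.2 (Real.one_le_exp (by positivity)))
  have hK := RectifiedFlow.oscConst_nonneg (lo := lo) (hi := hi) d hD (hp₀.div_nonneg hlo hne)
    (half_pos hμ).le
  rcases hstab with h0 | ⟨ha1, hu, hle⟩
  · rw [h0]
    exact ⟨RectifiedFlow.psiInv_nonneg _ _, fun L _ => by positivity⟩
  · have hle' := hle.trans (add_le_add_right hb _)
    refine ⟨hω.le_psiInv ha1 hu hle', fun L hL => ?_⟩
    have hL0 : 0 ≤ L := by have := hL 1 zero_le_one; linarith [hω.nonneg 1]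
    have e : C * (L + 1) / min ε γ * Real.log (D / ε) + C * (L + 1) / (ε * γ) =
        (L + 1) * (C / min ε γ * Real.log (D / ε) + C / (ε * γ)) := by ring
    rw [e]
    -- The comparison of Ψ with the logarithm needs a ≤ ‖R' 1 - R 1‖; otherwise the bound holds
    -- because the exponent is nonnegative.
    rcases le_total ‖R' 1 - R 1‖ a with h | h
    · exact h.trans (le_mul_of_one_le_right ha0
        (Real.one_le_exp (mul_nonneg (by linarith) (hK.trans hb))))
    · have h1 := hω.log_div_le hL ha1 h
      have h2 := h1.trans (mul_le_mul_of_nonneg_left (sub_le_iff_le_add'.2 hle')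
        (by linarith : 0 ≤ L + 1))
      rw [Real.log_le_iff_le_exp (div_pos hu ha1), div_le_iff₀ ha1] at h2
      linarith
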